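/- **Setting.** Let $\mathcal S,\mathcal A$ be finite sets with $|\mathcal S|=S$, $|\mathcal A|=A$, and consider an episodic MDP with horizon $H$, fixed known initial state $s_1$ and unknown transition kernels $P_h(s'\mid s,a)$, $h\in[H]$. A policy $\pi=(\pi_1,\dots,\pi_H)$ consists of maps $\pi_h:\mathcal S\to\Delta(\mathcal A)$. Let $d_h^\pi(s,a)=\mathbb P_\pi(s_h=s,a_h=a)$; for a reward function $r=(r_h)_{h\in[H]}$ with $r_h:\mathcal S\times\mathcal A\to[0,1]$ let $V^\pi(r)=\mathbb E_\pi\big[\sum_{h=1}^H r_h(s_h,a_h)\big]$ and $V^\star(r)=\sup_\pi V^\pi(r)$. A policy $\pi$ is $\epsilon$-optimal for $r$ if $V^\pi(r)\ge V^\star(r)-\epsilon$. Put $\mathcal S_1=\{s_1\}$ and $\mathcal S_h=\mathcal S$ for $2\le h\le H$, and let $$d_m=\min_{h\in[H]}\ \sup_\pi\ \min_{(s,a)\in\mathcal S_h\times\mathcal A} d_h^\pi(s,a).$$ Let $\Pi_0$ be the set of all deterministic policies and $\Delta(\Pi_0)$ the set of mixtures of them (a mixture draws one policy at the start of each episode).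 **Estimators.** Let $\mathcal D$ be a finite family of trajectories $(s_h^n,a_h^n)_{h\in[H]}$, let $\phi(s,a)=e_{(s,a)}\in\mathbb R^{SA}$, $\Lambda_h=I+\sum_n\phi(s_h^n,a_h^n)\phi(s_h^n,a_h^n)^\top$, and for $V:\mathcal S\to\mathbb R$ let $\bar w_h(V)=\Lambda_h^{-1}\sum_n\phi(s_h^n,a_h^n)V(s_{h+1}^n)$. Write $(x)_{[0,B]}=\max\{0,\min\{x,B\}\}$. - For $\pi\in\Pi_0$, $\widehat V^\pi(r)=V_1(s_1)$, where $V_{H+1}=0$ and $V_h(s)=\big(\phi(s,\pi_h(s))^\top\bar w_h(V_{h+1})+r_h(s,\pi_h(s))\big)_{[0,H]}$ for $h=H,\dots,1$ (with $\bar w_H(V_{H+1})=0$). - For $\pi\in\Pi_0$, $\widehat d_h^\pi(s,a)=V_1(s_1)$, where $V_h(s')=\mathbf 1[(s',\pi_h(s'))=(s,a)]$ and $V_{j}(s')=\big(\phi(s',\pi_{j}(s'))^\top\bar w_{j}(V_{j+1})\big)_{[0,1]}$ for $j=h-1,\dots,1$. For a mixture $\pi\in\Delta(\Pi_0)$ taking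 $\pi_i$ with probability $p_i$, $\widehat d_h^\pi=\sum_i p_i\widehat d_h^{\pi_i}$. **Exploration.** Given $\epsilon,\delta$ and constants $C_1,C_2,C_3$, set $\iota=\log\frac{SAH}{\epsilon\delta}$, $\bar\epsilon=\frac{C_1\epsilon}{H^2\sqrt S\,\iota}$ and $N=\big\lceil C_2SA\iota/\bar\epsilon^2\big\rceil$. For $h=1,\dots,H$, using all trajectories collected so far, let $$\pi_h\in\operatorname*{argmin}_{\substack{\pi\in\Delta(\Pi_0):\ \widehat d_h^\pi(s,a)\ge C_3H\sqrt S\,\bar\epsilon\,\iota\\ \forall (s,a)\in\mathcal S_h\times\mathcal A}}\ \max_{\widehat\pi\in\Pi_0}\sum_{(s,a)\in\mathcal S_h\times\mathcal A}\frac{\widehat d_h^{\widehat\pi}(s,a)}{\widehat d_h^\pi(s,a)}$$ (ties are broken arbitrarily, and $\pi_h$ is arbitrary if there is no minimizer), and deploy $\pi_h$ for $N$ episodes. **Planning.** From the complete dataset and a reward function $r$, return any $\widehat\pi\in\operatorname{argmax}_{\pi\in\Pi_0}\widehat V^\pi(r)$. **Theorem.** There are universal constants $C_1,C_2,C_3,C_4,C>0$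 such that the following holds for all finite $\mathcal S,\mathcal A$, all $H$, every MDP as above with $d_m>0$, and all $\delta\in(0,1)$ and $0<\epsilon\le\frac{Hd_m}{C_4SA}$. With probability at least $1-\delta$ over the exploration, simultaneously for every reward function $r$ with values in $[0,1]$, every policy that planning may return is $\epsilon$-optimal for $r$. The exploration uses $H$ deployments, each of the same number $N$ of trajectories fixed in advance, and in total $$HN\ \le\ C\,\frac{S^2AH^5}{\epsilon^2}\,\log^3\!\Big(\frac{SAH}{\epsilon\delta}\Big)=\widetilde O\Big(\frac{S^2AH^5}{\epsilon^2}\Big)$$ trajectories. -/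

import Mathlib

open scoped Matrix

noncomputable section

namespace TabularRF

/-- A finite-horizon tabular MDP with non-stationary transitions and a fixed initial state.
Layers are `0, …, H - 1`; `P h s a s'` is the probability of moving from `s` to `s'` when
action `a` is played at layer `h`. Rewards are not part of the model (reward-free setting). -/
structure MDP (S A : Type*) [Fintype S] (H : ℕ) where
  P : Fin H → S → A → S → ℝ
  P_mem : ∀ h s a, P h s a ∈ stdSimplex ℝ S
  s₁ : S

/-- A reward-free trajectory `(s_h, a_h)_h`. -/
abbrev Traj (S A : Type*) (H : ℕ) := Fin H → S × A

/-- Deterministic policies. The whole type is the policy set `Π₀`. -/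
abbrev DetPolicy (S A : Type*) (H : ℕ) := Fin H → S → A

/-- (Markov, randomized) policies. -/
abbrev Policy (S A : Type*) [Fintype A] (H : ℕ) :=
  {π : Fin H → S → A → ℝ // ∀ h s, π h s ∈ stdSimplex ℝ A}

/-- `Δ(Π₀)`: mixtures of deterministic policies (one policy is drawn per episode). -/
abbrev Mixture (S A : Type*) [Fintype S] [DecidableEq S] [Fintype A] (H : ℕ) :=
  stdSimplex ℝ (DetPolicy S A H)

/-- Reward functions: expected immediate rewards. -/
abbrev Reward (S A : Type*) (H : ℕ) := Fin H → S → A → ℝ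

/-- Valid rewards take values in `[0,1]`. -/
def IsValidReward {S A : Type*} {H : ℕ} (r : Reward S A H) : Prop :=
  ∀ h s a, r h s a ∈ Set.Icc (0 : ℝ) 1

section Basic

variable {S A : Type*} [Fintype S] [DecidableEq S] [Fintype A] [DecidableEq A] {H : ℕ}

/-- A deterministic policy as a (degenerate) randomized one. -/
def DetPolicy.toPolicy (π : DetPolicy S A H) : Policy S A H :=
  ⟨fun h s => Pi.single (π h s) 1, fun h s => single_mem_stdSimplex ℝ (π h s)⟩

/-- Probability of the state of `τ` at layer `h` given the previous state and action of `τ`. -/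
def MDP.stateProb (M : MDP S A H) (τ : Traj S A H) (h : Fin H) : ℝ :=
  if h.val = 0 then (if (τ h).1 = M.s₁ then 1 else 0)
  else
    let g : Fin H := ⟨h.val - 1, lt_of_le_of_lt (Nat.sub_le _ _) h.isLt⟩
    M.P g (τ g).1 (τ g).2 (τ h).1

/-- `ℙ_π(τ)`. -/
def MDP.trajProb (M : MDP S A H) (π : Policy S A H) (τ : Traj S A H) : ℝ :=
  ∏ h : Fin H, M.stateProb τ h * π.1 h (τ h).1 (τ h).2

/-- Law of one trajectory of a mixture of deterministic policies. -/
def MDP.mixTrajProb (M : MDP S A H) (w : Mixture S A H) (τ : Traj S A H) : ℝ :=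
  ∑ π : DetPolicy S A H, w.1 π * M.trajProb (DetPolicy.toPolicy π) τ

/-- Occupancy measure `d_h^π(s,a) = ℙ_π(s_h = s, a_h = a)`. -/
def MDP.occ (M : MDP S A H) (π : Policy S A H) (h : Fin H) (x : S × A) : ℝ :=
  ∑ τ : Traj S A H, if τ h = x then M.trajProb π τ else 0

/-- `V^π(r) = 𝔼_π[∑_h r_h(s_h, a_h)]`. -/
def MDP.value (M : MDP S A H) (π : Policy S A H) (r : Reward S A H) : ℝ :=
  ∑ τ : Traj S A H, M.trajProb π τ * ∑ h : Fin H, r h (τ h).1 (τ h).2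

/-- `V⋆(r)`. -/
def MDP.optValue (M : MDP S A H) (r : Reward S A H) : ℝ :=
  ⨆ π : Policy S A H, M.value π r

/-- `π` is `ε`-optimal with respect to `r`. -/
def MDP.IsEpsOptimal (M : MDP S A H) (ε : ℝ) (r : Reward S A H) (π : Policy S A H) : Prop :=
  M.optValue r - ε ≤ M.value π r

/-- State-action pairs of layer `h`. The initial state is fixed, so the only state of the first
layer is `s₁`; every other layer has all of `S`. -/
def layerPairs (s₁ : S) (h : Fin H) : Finset (S × A) :=
  if h.val = 0 then {s₁} ×ˢ Finset.univ else Finset.univ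

/-- `d_m = min_h sup_π min_{s,a} d_h^π(s,a)`, with `(s,a)` among the pairs of layer `h`. -/
def MDP.dm (M : MDP S A H) : ℝ :=
  ⨅ h : Fin H, ⨆ π : Policy S A H, ⨅ x : layerPairs (A := A) M.s₁ h, M.occ π h x.1

end Basic

section Estimation

variable {S A : Type*} [Fintype S] [DecidableEq S] [Fintype A] [DecidableEq A] {H : ℕ}
variable {I : Type*} [Fintype I]

/-- Truncation `(x)_{[0,B]}`. -/
def clip (B x : ℝ) : ℝ := max 0 (min x B)

/-- Canonical feature map `φ(s,a) = e_{(s,a)}`. -/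
def feature (x : S × A) : S × A → ℝ := Pi.single x 1

/-- `Λ_h = I + ∑_n φ(s_h^n,a_h^n) φ(s_h^n,a_h^n)ᵀ`. -/
def covMatrix (D : I → Traj S A H) (h : Fin H) : Matrix (S × A) (S × A) ℝ :=
  1 + ∑ n, Matrix.vecMulVec (feature (D n h)) (feature (D n h))

/-- `V(s_{h+1})` along the trajectory `τ`; after the last layer the continuation value is `0`. -/
def nextValue (τ : Traj S A H) (h : Fin H) (V : S → ℝ) : ℝ :=
  if hh : h.val + 1 < H then V (τ ⟨h.val + 1, hh⟩).1 else 0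

/-- `w̄_h = Λ_h⁻¹ ∑_n φ(s_h^n,a_h^n) V(s_{h+1}^n)`. -/
def lsviWeight (D : I → Traj S A H) (h : Fin H) (V : S → ℝ) : S × A → ℝ :=
  (covMatrix D h)⁻¹ *ᵥ ∑ n, nextValue (D n) h V • feature (D n h)

/-- `V_j` of `EstimateER` (estimation of `𝔼_π r(s_h,a_h)`, reward bound `B`), for `j ≤ h`:
`V_h(s) = r(s, π_h(s))` and `V_j(s) = (φ(s, π_j(s))ᵀ w̄_j)_{[0,B]}` for `j < h`. -/
def erV (D : I → Traj S A H) (π : DetPolicy S A H) (r : S → A → ℝ) (B : ℝ) (h : Fin H)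
    (j : ℕ) : S → ℝ :=
  if hj : j < h.val then
    let g : Fin H := ⟨j, hj.trans h.isLt⟩
    let w := lsviWeight D g (erV D π r B h (j + 1))
    fun s => clip B (feature (s, π g s) ⬝ᵥ w)
  else fun s => r s (π h s)
termination_by h.val - j

/-- Output of `EstimateER`. -/
def estimateER (D : I → Traj S A H) (s₁ : S) (π : DetPolicy S A H) (r : S → A → ℝ) (B : ℝ)
    (h : Fin H) : ℝ :=
  erV D π r B h 0 s₁

/-- `V_j` of `EstimateV`: `V_H = 0` (layers start at `0`) and
`V_j(s) = (φ(s, π_j(s))ᵀ w̄_j + r_j(s, π_j(s)))_{[0,H]}`. -/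
def evV (D : I → Traj S A H) (π : DetPolicy S A H) (r : Reward S A H) (j : ℕ) : S → ℝ :=
  if hj : j < H then
    let w := lsviWeight D ⟨j, hj⟩ (evV D π r (j + 1))
    fun s => clip H (feature (s, π ⟨j, hj⟩ s) ⬝ᵥ w + r ⟨j, hj⟩ s (π ⟨j, hj⟩ s))
  else 0
termination_by H - j

/-- Output `V̂^π(r)` of `EstimateV`. -/
def estimateV (D : I → Traj S A H) (s₁ : S) (π : DetPolicy S A H) (r : Reward S A H) : ℝ :=
  evV D π r 0 s₁

/-- `d̂_h^π(s,a)`: `EstimateER` applied to the indicator reward of `(s,a)`, with bound `1`. -/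
def estOcc (D : I → Traj S A H) (s₁ : S) (h : Fin H) (π : DetPolicy S A H) (x : S × A) : ℝ :=
  estimateER D s₁ π (fun s a => if (s, a) = x then 1 else 0) 1 h

/-- `d̂_h^w(s,a)` for a mixture `w`: the mixture of the estimates. -/
def estOccMix (D : I → Traj S A H) (s₁ : S) (h : Fin H) (w : Mixture S A H) (x : S × A) : ℝ :=
  ∑ π : DetPolicy S A H, w.1 π * estOcc D s₁ h π x

/-- The constraint `d̂_h^w(s,a) ≥ θ` for all `(s,a)`. -/
def IsFeasible (D : I → Traj S A H) (s₁ : S) (θ : ℝ) (h : Fin H) (w : Mixture S A H) : Prop :=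
  ∀ x ∈ layerPairs s₁ h, θ ≤ estOccMix D s₁ h w x

/-- `max_{π̂ ∈ Π₀} ∑_{s,a} d̂_h^π̂(s,a) / d̂_h^w(s,a)`. -/
def designObjective (D : I → Traj S A H) (s₁ : S) (h : Fin H) (w : Mixture S A H) : ℝ :=
  ⨆ π : DetPolicy S A H, ∑ x ∈ layerPairs s₁ h, estOcc D s₁ h π x / estOccMix D s₁ h w x

/-- `w` solves the constrained occupancy-ratio design problem of layer `h`. -/
def IsDesignSolution (D : I → Traj S A H) (s₁ : S) (θ : ℝ) (h : Fin H) (w : Mixture S A H) :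
    Prop :=
  IsFeasible D s₁ θ h w ∧
    ∀ w', IsFeasible D s₁ θ h w' → designObjective D s₁ h w ≤ designObjective D s₁ h w'

/-- Planning: `π̂ ∈ argmax_{π ∈ Π₀} V̂^π(r)` (any maximizer may be returned). -/
def IsPlanningOutput (D : I → Traj S A H) (s₁ : S) (r : Reward S A H) (π' : DetPolicy S A H) :
    Prop :=
  ∀ π : DetPolicy S A H, estimateV D s₁ π r ≤ estimateV D s₁ π' r

end Estimation

section Deployment

/-- An exploration procedure with `m` deployments of exactly `N` trajectories each, `m` and `N`
being fixed in advance: the mixture run in deployment `k` is a function of the trajectories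
collected in the deployments before `k`. -/
structure Scheme (S A : Type*) [Fintype S] [DecidableEq S] [Fintype A] (H m N : ℕ) where
  policy : (k : Fin m) → (Fin k.val → Fin N → Traj S A H) → Mixture S A H

variable {S A : Type*} [Fintype S] [DecidableEq S] [Fintype A] [DecidableEq A] {H m N : ℕ}

/-- The number of deployments. -/
def Scheme.deployments (_alg : Scheme S A H m N) : ℕ := m

/-- The total number of trajectories collected. -/
def Scheme.trajectories (_alg : Scheme S A H m N) : ℕ := Fintype.card (Fin m × Fin N)

/-- The mixture run in deployment `k` when the complete dataset is `D`. -/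
def Scheme.deployed (alg : Scheme S A H m N) (D : Fin m → Fin N → Traj S A H) (k : Fin m) :
    Mixture S A H :=
  alg.policy k (fun i n => D ⟨i.val, i.isLt.trans k.isLt⟩ n)

/-- Probability of collecting exactly the dataset `D` in the MDP `M`. -/
def Scheme.dataProb (alg : Scheme S A H m N) (M : MDP S A H)
    (D : Fin m → Fin N → Traj S A H) : ℝ :=
  ∏ k : Fin m, ∏ n : Fin N, M.mixTrajProb (alg.deployed D k) (D k n)

/-- Probability of an event about the collected dataset. -/
def Scheme.prob (alg : Scheme S A H m N) (M : MDP S A H)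
    (E : Set (Fin m → Fin N → Traj S A H)) : ℝ :=
  ∑ D : Fin m → Fin N → Traj S A H, E.indicator (alg.dataProb M) D

/-- A dataset of several deployments as one family of trajectories. -/
def pool {m : ℕ} (D : Fin m → Fin N → Traj S A H) : Fin m × Fin N → Traj S A H :=
  fun p => D p.1 p.2

/-- Layer-by-layer exploration with `H` deployments: deployment `h` runs a solution of the
design problem of layer `h` for the data collected so far, whenever a solution exists. Ties (and
the choice made when there is no solution) are arbitrary. -/
def Scheme.IsLayerwiseExploration (alg : Scheme S A H H N) (s₁ : S) (θ : ℝ) : Prop :=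
  ∀ (h : Fin H) (D : Fin h.val → Fin N → Traj S A H),
    (∃ w, IsDesignSolution (pool D) s₁ θ h w) →
      IsDesignSolution (pool D) s₁ θ h (alg.policy h D)

end Deployment

/-- `ι = log(dH / (εδ))` with `d = SA`. -/
def iota (S A H : ℕ) (ε δ : ℝ) : ℝ := Real.log ((S : ℝ) * A * H / (ε * δ))

/-- `ε̄ = C₁ ε / (H² √S ι)`. -/
def epsBar (C₁ : ℝ) (S A H : ℕ) (ε δ : ℝ) : ℝ :=
  C₁ * ε / ((H : ℝ) ^ 2 * Real.sqrt S * iota S A H ε δ)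

/-- `N = C₂ S A ι / ε̄²` trajectories per deployment, rounded up. -/
def batchSize (C₁ C₂ : ℝ) (S A H : ℕ) (ε δ : ℝ) : ℕ :=
  ⌈C₂ * S * A * iota S A H ε δ / epsBar C₁ S A H ε δ ^ 2⌉₊

/-- The lower bound `C₃ H √S ε̄ ι` in the constraint of the design problem. -/
def threshold (C₁ C₃ : ℝ) (S A H : ℕ) (ε δ : ℝ) : ℝ :=
  C₃ * H * Real.sqrt S * epsBar C₁ S A H ε δ * iota S A H ε δ

end TabularRF

end

set_option linter.unusedSectionVars false

noncomputable section

namespace TabularRF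

/-! ### Trajectory laws, values, occupancies and mixtures -/

section Trajectories

variable {S A : Type*} [Fintype S] [DecidableEq S] [Fintype A] [DecidableEq A] {H : ℕ}

/-! Write `η = ε / H`; with the constants chosen below the design threshold is exactly `η`. For
one-hot features the regression is an empirical mean with one extra count in the denominator, so its
error at a pair is governed by the deviation of the observed next states. A value function with
values in `[0,B]` deviates by at most `B` times the worst deviation over indicators of sets of
states (`MDP.abs_deviation_le`). This replaces all rewards and policies by `2 ^ S` sets, hence the
guarantee is uniform in `r` and the log factor is `L = 10 S ι`.

Unrolling dynamic programming along the true dynamics bounds the error of an estimate by the true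
value of the local errors (`MDP.abs_sub_value_le`). If layer `j` was sampled with occupancies `p`,
the local error at `x` is of order `√(L / (N p x))`, and Cauchy–Schwarz bounds its mean under `d` by
`√(L / N · ∑ d / p)`. The design keeps `∑ d / p ≤ 3 S A`: a maximizer of the product of the
mixture's estimated occupancies has all ratio sums at most the number of pairs, and averaging it
with a mixture that reaches every pair makes it feasible at the cost of a factor 2. Coverage is then
inductive: covered layers before `h` make the occupancy estimates at `h` accurate to `η / 8`, so
layer `h` is covered too.

The layers are concentrated jointly. A union bound layer by layer would cost `log H`, which `ι` need
not contain because `ε` can be of order `H`. Instead, one supermartingale multiplies exponential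
weights over all layers and deployments, and its exponent is below `H L` for every choice of one
(pair, set, temperature) per layer. Individual layers may be bad, but the accumulated error only
needs the sum over layers (`Scheme.value_localErr_le`). -/

theorem MDP.P_nonneg (M : MDP S A H) (h : Fin H) (s : S) (a : A) (s' : S) : 0 ≤ M.P h s a s' :=
  (M.P_mem h s a).1 s'

theorem MDP.sum_P (M : MDP S A H) (h : Fin H) (s : S) (a : A) : ∑ s', M.P h s a s' = 1 :=
  (M.P_mem h s a).2

/-- The MDP of the layers after the first one, started at `s`. -/
def MDP.tail (M : MDP S A (H + 1)) (s : S) : MDP S A H where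
  P h := M.P h.succ
  P_mem h := M.P_mem h.succ
  s₁ := s

/-- The policy of the layers after the first one. -/
def Policy.tail (π : Policy S A (H + 1)) : Policy S A H :=
  ⟨fun h => π.1 h.succ, fun h => π.2 h.succ⟩

theorem MDP.stateProb_nonneg (M : MDP S A H) (τ : Traj S A H) (h : Fin H) :
    0 ≤ M.stateProb τ h := by
  unfold MDP.stateProb
  split_ifs
  · exact zero_le_one
  · exact le_rfl
  · exact M.P_nonneg _ _ _ _

theorem MDP.trajProb_nonneg (M : MDP S A H) (π : Policy S A H) (τ : Traj S A H) :
    0 ≤ M.trajProb π τ :=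
  Finset.prod_nonneg fun h _ => mul_nonneg (M.stateProb_nonneg τ h) ((π.2 h _).1 _)

theorem MDP.trajProb_eq_zero (M : MDP S A (H + 1)) (π : Policy S A (H + 1))
    (τ : Traj S A (H + 1)) (h : (τ 0).1 ≠ M.s₁) : M.trajProb π τ = 0 := by
  refine Finset.prod_eq_zero (Finset.mem_univ 0) ?_
  simp [MDP.stateProb, h]

/-- The tail determines its own initial state, so a single `s'` contributes. An empty tail has no
such state, and the sum is then the total mass of the kernel. -/
theorem MDP.trajProb_cons (M : MDP S A (H + 1)) (π : Policy S A (H + 1)) (x : S × A)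
    (τ : Traj S A H) :
    M.trajProb π (Fin.cons x τ) =
      (if x.1 = M.s₁ then 1 else 0) * π.1 0 x.1 x.2 *
        ∑ s', M.P 0 x.1 x.2 s' * (M.tail s').trajProb π.tail τ := by
  unfold MDP.trajProb
  rw [Fin.prod_univ_succ]
  congr 1
  cases H with
  | zero => simp [M.sum_P]
  | succ n =>
    rw [Finset.sum_eq_single (τ 0).1]
    · rw [Fin.prod_univ_succ, Fin.prod_univ_succ, ← mul_assoc]
      congr 1
      simp [MDP.stateProb, MDP.tail, Policy.tail]
    · intro s' _ hs'
      rw [Fin.prod_univ_succ]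
      simp [MDP.stateProb, MDP.tail, hs'.symm]
    · simp

/-- Expectation of a function of the trajectory. -/
def MDP.expect (M : MDP S A H) (π : Policy S A H) (F : Traj S A H → ℝ) : ℝ :=
  ∑ τ, M.trajProb π τ * F τ

theorem MDP.expect_congr (M : MDP S A (H + 1)) (π : Policy S A (H + 1))
    {F G : Traj S A (H + 1) → ℝ} (h : ∀ τ, (τ 0).1 = M.s₁ → F τ = G τ) :
    M.expect π F = M.expect π G := by
  refine Finset.sum_congr rfl fun τ _ => ?_
  by_cases hτ : (τ 0).1 = M.s₁
  · rw [h τ hτ]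
  · rw [M.trajProb_eq_zero π τ hτ, zero_mul, zero_mul]

theorem MDP.expect_mono (M : MDP S A H) (π : Policy S A H)
    {F G : Traj S A H → ℝ} (h : ∀ τ, F τ ≤ G τ) : M.expect π F ≤ M.expect π G :=
  Finset.sum_le_sum fun τ _ => mul_le_mul_of_nonneg_left (h τ) (M.trajProb_nonneg π τ)

theorem MDP.expect_const_mul (M : MDP S A H) (π : Policy S A H) (c : ℝ) (F : Traj S A H → ℝ) :
    M.expect π (fun τ => c * F τ) = c * M.expect π F := by
  simp [MDP.expect, Finset.mul_sum, mul_left_comm]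

theorem MDP.expect_add (M : MDP S A H) (π : Policy S A H) (F G : Traj S A H → ℝ) :
    M.expect π (fun τ => F τ + G τ) = M.expect π F + M.expect π G := by
  simp [MDP.expect, mul_add, Finset.sum_add_distrib]

theorem MDP.expect_zero (M : MDP S A 0) (π : Policy S A 0) (F : Traj S A 0 → ℝ) :
    M.expect π F = F default := by
  simp [MDP.expect, MDP.trajProb]

/-- Conditioning on the first action and the second state. -/
theorem MDP.expect_succ (M : MDP S A (H + 1)) (π : Policy S A (H + 1))
    (F : Traj S A (H + 1) → ℝ) :
    M.expect π F = ∑ a, π.1 0 M.s₁ a * ∑ s', M.P 0 M.s₁ a s' *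
      (M.tail s').expect π.tail (fun τ => F (Fin.cons (M.s₁, a) τ)) := by
  unfold MDP.expect
  have hcons : ∀ f : Traj S A (H + 1) → ℝ,
      ∑ τ, f τ = ∑ s, ∑ a, ∑ τ : Traj S A H, f (Fin.cons (s, a) τ) := by
    intro f
    rw [← (Fin.consEquiv fun _ : Fin (H + 1) => S × A).sum_comp f, Fintype.sum_prod_type,
      Fintype.sum_prod_type]
    rfl
  rw [hcons, Finset.sum_eq_single M.s₁]
  · refine Finset.sum_congr rfl fun a _ => ?_
    simp only [MDP.trajProb_cons, if_true, one_mul, Finset.mul_sum,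
      Finset.sum_mul]
    rw [Finset.sum_comm]
    refine Finset.sum_congr rfl fun s' _ => Finset.sum_congr rfl fun τ _ => ?_
    ring
  · intro s _ hs
    refine Finset.sum_eq_zero fun a _ => Finset.sum_eq_zero fun τ _ => ?_
    simp [MDP.trajProb_cons, hs]
  · simp

theorem MDP.expect_one (M : MDP S A H) (π : Policy S A H) : M.expect π (fun _ => 1) = 1 := by
  induction H with
  | zero => exact M.expect_zero π _
  | succ n ih =>
    rw [M.expect_succ]
    simp [ih, M.sum_P, (π.2 0 M.s₁).2]

theorem MDP.sum_trajProb (M : MDP S A H) (π : Policy S A H) : ∑ τ, M.trajProb π τ = 1 := by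
  simpa [MDP.expect] using M.expect_one π

/-- Product along a trajectory of weights of its transitions. -/
def transProd (G : Fin H → S × A → S → ℝ) (τ : Traj S A H) : ℝ :=
  ∏ j : Fin H, if hj : j.val + 1 < H then G j (τ j) (τ ⟨j.val + 1, hj⟩).1 else 1

/-- Supermartingale property inside one trajectory: condition on the first transition and apply
induction to the tail. The last layer has no transition, hence the factor 1 in `transProd`. -/
theorem MDP.expect_transProd_le_one (M : MDP S A H) (π : Policy S A H)
    (G : Fin H → S × A → S → ℝ) (hG : ∀ j x s, 0 ≤ G j x s)
    (h : ∀ j x, ∑ s', M.P j x.1 x.2 s' * G j x s' ≤ 1) :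
    M.expect π (transProd G) ≤ 1 := by
  induction H with
  | zero => simp [M.expect_zero, transProd]
  | succ n ih =>
    have key : ∀ a, ∑ s', M.P 0 M.s₁ a s' *
        (M.tail s').expect π.tail (fun τ => transProd G (Fin.cons (M.s₁, a) τ)) ≤ 1 := by
      intro a
      have hrec : ∀ s', (M.tail s').expect π.tail (transProd fun j => G j.succ) ≤ 1 :=
        fun s' => ih (M.tail s') π.tail _ (fun j => hG j.succ) (fun j x => h j.succ x)
      cases n with
      | zero =>
        simp [MDP.expect_zero, transProd, M.sum_P]
      | succ n =>
        refine le_trans (Finset.sum_le_sum fun s' _ => ?_) (h 0 (M.s₁, a))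
        refine mul_le_mul_of_nonneg_left ?_ (M.P_nonneg _ _ _ _)
        have : (M.tail s').expect π.tail (fun τ => transProd G (Fin.cons (M.s₁, a) τ)) =
            (M.tail s').expect π.tail
              (fun τ => G 0 (M.s₁, a) s' * transProd (fun j => G j.succ) τ) := by
          refine MDP.expect_congr _ _ fun τ hτ => ?_
          unfold transProd
          rw [Fin.prod_univ_succ]
          congr 1
          · have : (τ 0).1 = s' := hτ
            simp [← this]
          · refine Finset.prod_congr rfl fun j _ => ?_
            simp only [Fin.val_succ, add_lt_add_iff_right, Fin.cons_succ]
            rfl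
        rw [this, MDP.expect_const_mul]
        exact mul_le_of_le_one_right (hG _ _ _) (hrec s')
    rw [M.expect_succ]
    calc _ ≤ ∑ a, π.1 0 M.s₁ a * 1 :=
          Finset.sum_le_sum fun a _ => mul_le_mul_of_nonneg_left (key a) ((π.2 0 M.s₁).1 a)
      _ = 1 := by simp [(π.2 0 M.s₁).2]

theorem MDP.value_eq_expect (M : MDP S A H) (π : Policy S A H) (r : Reward S A H) :
    M.value π r = M.expect π (fun τ => ∑ h, r h (τ h).1 (τ h).2) := rfl

theorem MDP.value_succ (M : MDP S A (H + 1)) (π : Policy S A (H + 1)) (r : Reward S A (H + 1)) :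
    M.value π r = ∑ a, π.1 0 M.s₁ a * (r 0 M.s₁ a + ∑ s', M.P 0 M.s₁ a s' *
      (M.tail s').value π.tail fun h => r h.succ) := by
  rw [M.value_eq_expect, M.expect_succ]
  refine Finset.sum_congr rfl fun a _ => ?_
  congr 1
  have : ∀ s', (M.tail s').expect π.tail (fun τ => ∑ h : Fin (H + 1),
      r h ((Fin.cons (M.s₁, a) τ : Traj S A (H + 1)) h).1
        ((Fin.cons (M.s₁, a) τ : Traj S A (H + 1)) h).2) =
      r 0 M.s₁ a + (M.tail s').value π.tail fun h => r h.succ := by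
    intro s'
    rw [MDP.value_eq_expect, ← mul_one (r 0 M.s₁ a), ← MDP.expect_one (M.tail s') π.tail,
      ← MDP.expect_const_mul, ← MDP.expect_add]
    simp [Fin.sum_univ_succ]
  simp only [this, mul_add, Finset.sum_add_distrib, ← Finset.sum_mul, M.sum_P, one_mul]

theorem MDP.value_eq_sum_occ (M : MDP S A H) (π : Policy S A H) (r : Reward S A H) :
    M.value π r = ∑ h, ∑ x : S × A, M.occ π h x * r h x.1 x.2 := by
  unfold MDP.value MDP.occ
  simp only [Finset.mul_sum, Finset.sum_mul]
  rw [Finset.sum_comm]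
  refine Finset.sum_congr rfl fun h _ => ?_
  rw [Finset.sum_comm]
  refine Finset.sum_congr rfl fun τ _ => ?_
  simp [ite_mul]

theorem MDP.occ_nonneg (M : MDP S A H) (π : Policy S A H) (h : Fin H) (x : S × A) :
    0 ≤ M.occ π h x :=
  Finset.sum_nonneg fun τ _ => by
    split_ifs
    exacts [M.trajProb_nonneg π τ, le_rfl]

theorem MDP.sum_occ (M : MDP S A H) (π : Policy S A H) (h : Fin H) : ∑ x, M.occ π h x = 1 := by
  unfold MDP.occ
  rw [Finset.sum_comm]
  simp [M.sum_trajProb]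

theorem MDP.occ_eq_zero (M : MDP S A H) (π : Policy S A H) (h : Fin H) (x : S × A)
    (hx : x ∉ layerPairs M.s₁ h) : M.occ π h x = 0 := by
  unfold layerPairs at hx
  split_ifs at hx with h0
  · refine Finset.sum_eq_zero fun τ _ => ?_
    split_ifs with hτ
    · cases H with
      | zero => exact h.elim0
      | succ n =>
        have : h = 0 := Fin.ext h0
        subst this
        refine M.trajProb_eq_zero π τ fun h1 => hx ?_
        simp [← h1, ← hτ]
    · rfl
  · simp at hx

theorem MDP.occ_eq_value (M : MDP S A H) (π : Policy S A H) (h : Fin H) (x : S × A) :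
    M.occ π h x = M.value π fun j s a => if j = h ∧ (s, a) = x then 1 else 0 := by
  rw [M.value_eq_sum_occ, Finset.sum_eq_single h, Finset.sum_eq_single x]
  · simp
  · intro y _ hy
    simp [hy]
  · simp
  · intro j _ hj
    simp [hj]
  · simp

/-- Backward recursion for the value of a deterministic policy. -/
def MDP.detVal (M : MDP S A H) (π : DetPolicy S A H) (r : Reward S A H) (j : ℕ) : S → ℝ :=
  if hj : j < H then fun s => r ⟨j, hj⟩ s (π ⟨j, hj⟩ s) +
      ∑ s', M.P ⟨j, hj⟩ s (π ⟨j, hj⟩ s) s' * M.detVal π r (j + 1) s'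
  else 0
termination_by H - j

theorem MDP.detVal_of_lt (M : MDP S A H) (π : DetPolicy S A H) (r : Reward S A H) {j : ℕ}
    (hj : j < H) (s : S) : M.detVal π r j s = r ⟨j, hj⟩ s (π ⟨j, hj⟩ s) +
      ∑ s', M.P ⟨j, hj⟩ s (π ⟨j, hj⟩ s) s' * M.detVal π r (j + 1) s' := by
  rw [MDP.detVal, dif_pos hj]

theorem MDP.detVal_of_le (M : MDP S A H) (π : DetPolicy S A H) (r : Reward S A H) {j : ℕ}
    (hj : H ≤ j) : M.detVal π r j = 0 := by
  rw [MDP.detVal, dif_neg (not_lt.2 hj)]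

theorem MDP.detVal_succ (M : MDP S A (H + 1)) (π : DetPolicy S A (H + 1))
    (r : Reward S A (H + 1)) (s₀ : S) (j : ℕ) :
    M.detVal π r (j + 1) =
      (M.tail s₀).detVal (fun h => π h.succ) (fun h => r h.succ) j := by
  by_cases hj : j < H
  · have ih := M.detVal_succ π r s₀ (j + 1)
    funext s
    rw [MDP.detVal_of_lt _ _ _ hj, MDP.detVal_of_lt _ _ _ (Nat.succ_lt_succ hj), ih]
    rfl
  · rw [MDP.detVal_of_le _ _ _ (not_lt.1 hj), MDP.detVal_of_le _ _ _ (by omega)]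
termination_by H - j

theorem MDP.value_toPolicy (M : MDP S A H) (π : DetPolicy S A H) (r : Reward S A H) :
    M.value (DetPolicy.toPolicy π) r = M.detVal π r 0 M.s₁ := by
  induction H with
  | zero => simp [MDP.value, MDP.detVal]
  | succ n ih =>
    rw [M.value_succ, M.detVal_of_lt _ _ (Nat.succ_pos n), Finset.sum_eq_single (π 0 M.s₁)]
    · have : Policy.tail (DetPolicy.toPolicy π) = DetPolicy.toPolicy fun h => π h.succ := rfl
      simp only [this, ih, zero_add]
      simp only [DetPolicy.toPolicy, Pi.single_eq_same, one_mul]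
      congr 1
      refine Finset.sum_congr rfl fun s' _ => ?_
      congr 1
      exact (congrFun (M.detVal_succ π r s' 0) s').symm
    · intro a _ ha
      simp [DetPolicy.toPolicy, ha]
    · simp

/-- The error of approximate dynamic programming is at most the value of its local errors. -/
theorem MDP.abs_sub_value_le (M : MDP S A H) (π : DetPolicy S A H) (r b : Reward S A H)
    (U : ℕ → S → ℝ) (hU : U H = 0)
    (h : ∀ (j : Fin H) (s : S), |U j s - M.detVal π r j s| ≤ b j s (π j s) +
      ∑ s', M.P j s (π j s) s' * |U (j + 1) s' - M.detVal π r (j + 1) s'|) :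
    |U 0 M.s₁ - M.value (DetPolicy.toPolicy π) r| ≤ M.value (DetPolicy.toPolicy π) b := by
  -- Backward induction on the number `i` of remaining layers: the error obeys the Bellman recursion
  -- of the reward `b` with an inequality.
  have key : ∀ i j, i + j = H → ∀ s, |U j s - M.detVal π r j s| ≤ M.detVal π b j s := by
    intro i
    induction i with
    | zero =>
      intro j hj s
      rw [M.detVal_of_le _ _ (by omega), M.detVal_of_le _ _ (by omega),
        show j = H by omega, hU]
      simp
    | succ i ih =>
      intro j hj s
      have hjH : j < H := by omega
      refine (h ⟨j, hjH⟩ s).trans ?_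
      rw [M.detVal_of_lt π b hjH]
      refine add_le_add_right (Finset.sum_le_sum fun s' _ => ?_) _
      exact mul_le_mul_of_nonneg_left (ih (j + 1) (by omega) s') (M.P_nonneg _ _ _ _)
  rw [M.value_toPolicy, M.value_toPolicy]
  exact key H 0 (by omega) M.s₁

theorem MDP.detVal_mem_Icc (M : MDP S A H) (π : DetPolicy S A H) (r : Reward S A H)
    (hr : IsValidReward r) (j : ℕ) (s : S) : M.detVal π r j s ∈ Set.Icc 0 (H : ℝ) := by
  have key : ∀ i j, i + j = H → ∀ s, M.detVal π r j s ∈ Set.Icc 0 (i : ℝ) := by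
    intro i
    induction i with
    | zero =>
      intro j hj s
      rw [M.detVal_of_le _ _ (by omega)]
      simp
    | succ i ih =>
      intro j hj s
      have hjH : j < H := by omega
      rw [M.detVal_of_lt π r hjH]
      have h0 := hr ⟨j, hjH⟩ s (π ⟨j, hjH⟩ s)
      have h1 : 0 ≤ ∑ s', M.P ⟨j, hjH⟩ s (π ⟨j, hjH⟩ s) s' * M.detVal π r (j + 1) s' :=
        Finset.sum_nonneg fun s' _ =>
          mul_nonneg (M.P_nonneg _ _ _ _) (ih (j + 1) (by omega) s').1
      have h2 : ∑ s', M.P ⟨j, hjH⟩ s (π ⟨j, hjH⟩ s) s' * M.detVal π r (j + 1) s' ≤ i := by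
        calc _ ≤ ∑ s', M.P ⟨j, hjH⟩ s (π ⟨j, hjH⟩ s) s' * (i : ℝ) :=
              Finset.sum_le_sum fun s' _ => mul_le_mul_of_nonneg_left
                (ih (j + 1) (by omega) s').2 (M.P_nonneg _ _ _ _)
          _ = i := by rw [← Finset.sum_mul, M.sum_P, one_mul]
      push_cast
      exact ⟨by linarith [h0.1], by linarith [h0.2]⟩
  rcases le_or_gt j H with hj | hj
  · have := key (H - j) j (by omega) s
    refine ⟨this.1, this.2.trans ?_⟩
    exact_mod_cast Nat.sub_le _ _
  · rw [M.detVal_of_le _ _ hj.le]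
    simp

/-- Every Markov policy has the trajectory law of a mixture of deterministic policies. -/
theorem MDP.exists_mixture (M : MDP S A H) (π : Policy S A H) :
    ∃ w : Mixture S A H, ∀ τ, M.mixTrajProb w τ = M.trajProb π τ := by
  have hsum : ∀ g : Fin H × S → A → ℝ,
      ∑ ρ : DetPolicy S A H, ∏ p : Fin H × S, g p (ρ p.1 p.2) = ∏ p : Fin H × S, ∑ a, g p a := by
    intro g
    rw [Finset.prod_univ_sum, Fintype.piFinset_univ]
    exact (Equiv.curry (Fin H) S A).symm.sum_comp fun ρ => ∏ p : Fin H × S, g p (ρ p)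
  -- Draw the action of every (layer, state) pair independently. A trajectory tests one state per
  -- layer; the unvisited factors sum to one.
  refine ⟨⟨fun ρ => ∏ p : Fin H × S, π.1 p.1 p.2 (ρ p.1 p.2), ?_, ?_⟩, fun τ => ?_⟩
  · exact fun ρ => Finset.prod_nonneg fun p _ => (π.2 _ _).1 _
  · rw [hsum fun p a => π.1 p.1 p.2 a]
    exact Finset.prod_eq_one fun p _ => (π.2 _ _).2
  · unfold MDP.mixTrajProb MDP.trajProb
    simp only [Finset.prod_mul_distrib, mul_left_comm _ (∏ h, M.stateProb τ h), ← Finset.mul_sum]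
    congr 1
    have h1 : ∀ ρ : DetPolicy S A H, (∏ h, (DetPolicy.toPolicy ρ).1 h (τ h).1 (τ h).2) =
        ∏ p : Fin H × S, if p.2 = (τ p.1).1 then
          (if ρ p.1 p.2 = (τ p.1).2 then (1 : ℝ) else 0) else 1 := by
      intro ρ
      rw [Fintype.prod_prod_type]
      refine Finset.prod_congr rfl fun h _ => ?_
      rw [Finset.prod_eq_single (τ h).1]
      · simp [DetPolicy.toPolicy, Pi.single_apply, eq_comm]
      · intro s _ hs
        simp [hs]
      · simp
    simp only [h1, ← Finset.prod_mul_distrib]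
    rw [hsum fun p a => π.1 p.1 p.2 a * if p.2 = (τ p.1).1 then
          (if a = (τ p.1).2 then (1 : ℝ) else 0) else 1, Fintype.prod_prod_type]
    refine Finset.prod_congr rfl fun h _ => ?_
    rw [Finset.prod_eq_single (τ h).1]
    · simp
    · intro s _ hs
      simp [hs, (π.2 h s).2]
    · simp

/-- Occupancy measure of a mixture. -/
def MDP.mixOcc (M : MDP S A H) (w : Mixture S A H) (h : Fin H) (x : S × A) : ℝ :=
  ∑ π : DetPolicy S A H, w.1 π * M.occ (DetPolicy.toPolicy π) h x

theorem MDP.mixOcc_eq (M : MDP S A H) (w : Mixture S A H) (h : Fin H) (x : S × A) :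
    M.mixOcc w h x = ∑ τ, if τ h = x then M.mixTrajProb w τ else 0 := by
  unfold MDP.mixOcc MDP.occ MDP.mixTrajProb
  simp only [Finset.mul_sum]
  rw [Finset.sum_comm]
  refine Finset.sum_congr rfl fun τ _ => ?_
  split_ifs <;> simp

theorem MDP.exists_mixOcc_eq (M : MDP S A H) (π : Policy S A H) :
    ∃ w : Mixture S A H, ∀ h x, M.mixOcc w h x = M.occ π h x := by
  obtain ⟨w, hw⟩ := M.exists_mixture π
  refine ⟨w, fun h x => ?_⟩
  rw [M.mixOcc_eq]
  simp only [hw]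
  rfl

theorem MDP.mixTrajProb_nonneg (M : MDP S A H) (w : Mixture S A H) (τ : Traj S A H) :
    0 ≤ M.mixTrajProb w τ :=
  Finset.sum_nonneg fun π _ => mul_nonneg (w.2.1 π) (M.trajProb_nonneg _ _)

theorem MDP.sum_mixTrajProb_mul (M : MDP S A H) (w : Mixture S A H) (F : Traj S A H → ℝ) :
    ∑ τ, M.mixTrajProb w τ * F τ = ∑ π, w.1 π * M.expect (DetPolicy.toPolicy π) F := by
  unfold MDP.mixTrajProb MDP.expect
  simp only [Finset.mul_sum, Finset.sum_mul]
  rw [Finset.sum_comm]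
  simp only [mul_assoc]

theorem MDP.sum_mixTrajProb (M : MDP S A H) (w : Mixture S A H) :
    ∑ τ, M.mixTrajProb w τ = 1 := by
  have := M.sum_mixTrajProb_mul w fun _ => 1
  simpa [MDP.expect_one, w.2.2] using this

/-- The value is an average over the components of an equivalent mixture, and some component is at
least the average. Thus planning over `Π₀` competes with all randomized policies. -/
theorem MDP.exists_value_le (M : MDP S A H) (π : Policy S A H) (r : Reward S A H) :
    ∃ ρ : DetPolicy S A H, M.value π r ≤ M.value (DetPolicy.toPolicy ρ) r := by
  obtain ⟨w, hw⟩ := M.exists_mixture π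
  by_contra! hlt
  have h1 : M.value π r = ∑ ρ, w.1 ρ * M.value (DetPolicy.toPolicy ρ) r := by
    rw [M.value_eq_expect]
    simp only [M.value_eq_expect]
    rw [← M.sum_mixTrajProb_mul]
    simp only [hw]
    rfl
  obtain ⟨ρ, hρ⟩ : ∃ ρ, 0 < w.1 ρ := by
    by_contra! hle
    have := w.2.2
    have h2 : ∑ ρ, w.1 ρ ≤ 0 := Finset.sum_nonpos fun ρ _ => hle ρ
    linarith
  have h3 : ∑ ρ, w.1 ρ * M.value (DetPolicy.toPolicy ρ) r < ∑ ρ, w.1 ρ * M.value π r :=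
    Finset.sum_lt_sum (fun ρ _ => mul_le_mul_of_nonneg_left (hlt ρ).le (w.2.1 ρ))
      ⟨ρ, Finset.mem_univ _, mul_lt_mul_of_pos_left (hlt ρ) hρ⟩
  rw [← h1, ← Finset.sum_mul, w.2.2, one_mul] at h3
  exact lt_irrefl _ h3

end Trajectories

/-! ### Regression errors and their propagation -/

section EstimationError

variable {S A : Type*} [Fintype S] [DecidableEq S] [Fintype A] [DecidableEq A] {H : ℕ}
variable {I : Type*} [Fintype I]

/-- Number of visits of the pair `x` at layer `h`. -/
def visits (D : I → Traj S A H) (h : Fin H) (x : S × A) : ℝ :=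
  ∑ n, if D n h = x then 1 else 0

theorem visits_nonneg (D : I → Traj S A H) (h : Fin H) (x : S × A) : 0 ≤ visits D h x :=
  Finset.sum_nonneg fun n _ => by split_ifs <;> norm_num

theorem covMatrix_eq_diagonal (D : I → Traj S A H) (h : Fin H) :
    covMatrix D h = Matrix.diagonal fun x => 1 + visits D h x := by
  ext x y
  have hxy : ∀ n, Matrix.vecMulVec (feature (D n h)) (feature (D n h)) x y =
      if x = y then (if D n h = x then (1 : ℝ) else 0) else 0 := by
    intro n
    simp only [Matrix.vecMulVec_apply, feature, Pi.single_apply]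
    grind
  simp only [covMatrix, Matrix.add_apply, Matrix.sum_apply, hxy, Matrix.diagonal_apply,
    Matrix.one_apply, visits]
  split_ifs <;> simp

theorem lsviWeight_apply (D : I → Traj S A H) (h : Fin H) (V : S → ℝ) (x : S × A) :
    lsviWeight D h V x =
      (∑ n, if D n h = x then nextValue (D n) h V else 0) / (1 + visits D h x) := by
  have hinv : (covMatrix D h)⁻¹ = Matrix.diagonal fun x => (1 + visits D h x)⁻¹ := by
    refine Matrix.inv_eq_right_inv ?_
    rw [covMatrix_eq_diagonal, Matrix.diagonal_mul_diagonal, ← Matrix.diagonal_one]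
    congr 1
    funext y
    exact mul_inv_cancel₀ (by linarith [visits_nonneg D h y])
  rw [lsviWeight, hinv, Matrix.mulVec_diagonal, div_eq_inv_mul]
  congr 1
  rw [Finset.sum_apply]
  refine Finset.sum_congr rfl fun n _ => ?_
  simp [feature, Pi.single_apply, eq_comm]

/-- Conditional mean of `nextValue`. -/
def MDP.nextMean (M : MDP S A H) (h : Fin H) (V : S → ℝ) (x : S × A) : ℝ :=
  if h.val + 1 < H then ∑ s', M.P h x.1 x.2 s' * V s' else 0

/-- Sum of the deviations of `nextValue` from its conditional mean over the visits of `x`. -/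
def MDP.deviation (M : MDP S A H) (D : I → Traj S A H) (h : Fin H) (x : S × A) (V : S → ℝ) : ℝ :=
  ∑ n, if D n h = x then nextValue (D n) h V - M.nextMean h V x else 0

/-- Indicator function of a set of states. -/
def stateInd (T : Finset S) (s : S) : ℝ := if s ∈ T then 1 else 0

theorem nextValue_eq_sum (τ : Traj S A H) (h : Fin H) (V : S → ℝ) :
    nextValue τ h V = ∑ s, V s * nextValue τ h (stateInd {s}) := by
  unfold nextValue
  split_ifs <;> simp [stateInd]

theorem MDP.nextMean_eq_sum (M : MDP S A H) (h : Fin H) (V : S → ℝ) (x : S × A) :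
    M.nextMean h V x = ∑ s, V s * M.nextMean h (stateInd {s}) x := by
  unfold MDP.nextMean
  split_ifs <;> simp [stateInd, mul_comm]

theorem MDP.deviation_eq_sum (M : MDP S A H) (D : I → Traj S A H) (h : Fin H) (x : S × A)
    (V : S → ℝ) : M.deviation D h x V = ∑ s, V s * M.deviation D h x (stateInd {s}) := by
  unfold MDP.deviation
  simp only [Finset.mul_sum]
  rw [Finset.sum_comm]
  refine Finset.sum_congr rfl fun n _ => ?_
  split_ifs
  · rw [nextValue_eq_sum, M.nextMean_eq_sum, ← Finset.sum_sub_distrib]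
    simp only [mul_sub]
  · simp

theorem MDP.deviation_one (M : MDP S A H) (D : I → Traj S A H) (h : Fin H) (x : S × A) :
    M.deviation D h x (fun _ => 1) = 0 := by
  refine Finset.sum_eq_zero fun n _ => ?_
  unfold nextValue MDP.nextMean
  split_ifs <;> simp [M.sum_P]

/-- Largest deviation among indicator functions. -/
def MDP.maxDev (M : MDP S A H) (D : I → Traj S A H) (h : Fin H) (x : S × A) : ℝ :=
  Finset.univ.sup' Finset.univ_nonempty fun T : Finset S => M.deviation D h x (stateInd T)

theorem MDP.le_maxDev (M : MDP S A H) (D : I → Traj S A H) (h : Fin H) (x : S × A)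
    (T : Finset S) : M.deviation D h x (stateInd T) ≤ M.maxDev D h x :=
  Finset.le_sup' (fun T : Finset S => M.deviation D h x (stateInd T)) (Finset.mem_univ T)

theorem MDP.exists_maxDev_eq (M : MDP S A H) (D : I → Traj S A H) (h : Fin H) (x : S × A) :
    ∃ T : Finset S, M.maxDev D h x = M.deviation D h x (stateInd T) := by
  obtain ⟨T, -, hT⟩ := Finset.exists_mem_eq_sup' Finset.univ_nonempty
    fun T : Finset S => M.deviation D h x (stateInd T)
  exact ⟨T, hT⟩

/-- The deviation is linear in `V`, so over the cube `[0,B]^S` it is largest at a vertex: `B` times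
the indicator of the states with nonnegative coefficient. -/
theorem MDP.deviation_le (M : MDP S A H) (D : I → Traj S A H) (h : Fin H) (x : S × A)
    {V : S → ℝ} {B : ℝ} (hV : ∀ s, V s ∈ Set.Icc 0 B) :
    M.deviation D h x V ≤ B * M.maxDev D h x := by
  have hB : 0 ≤ B := (hV M.s₁).1.trans (hV M.s₁).2
  set c : S → ℝ := fun s => M.deviation D h x (stateInd {s}) with hc
  have hT := M.le_maxDev D h x (Finset.univ.filter fun s => 0 ≤ c s)
  rw [M.deviation_eq_sum] at hT
  rw [M.deviation_eq_sum]
  refine le_trans ?_ (mul_le_mul_of_nonneg_left hT hB)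
  rw [Finset.mul_sum]
  refine Finset.sum_le_sum fun s _ => ?_
  change V s * c s ≤ B * (_ * c s)
  by_cases hs : 0 ≤ c s
  · simpa [stateInd, hs] using mul_le_mul_of_nonneg_right (hV s).2 hs
  · simpa [stateInd, hs] using mul_nonpos_of_nonneg_of_nonpos (hV s).1 (not_le.1 hs).le

/-- Constants do not deviate, so the lower bound for `V` is the upper bound for `B - V`. -/
theorem MDP.abs_deviation_le (M : MDP S A H) (D : I → Traj S A H) (h : Fin H) (x : S × A)
    {V : S → ℝ} {B : ℝ} (hV : ∀ s, V s ∈ Set.Icc 0 B) :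
    |M.deviation D h x V| ≤ B * M.maxDev D h x := by
  refine abs_le.2 ⟨?_, M.deviation_le D h x hV⟩
  have h1 : M.deviation D h x (fun s => B - V s) ≤ B * M.maxDev D h x :=
    M.deviation_le D h x fun s => ⟨by linarith [(hV s).2], by linarith [(hV s).1]⟩
  have h2 := M.deviation_one D h x
  rw [M.deviation_eq_sum] at h1 h2 ⊢
  simp only [one_mul] at h2
  simp only [sub_mul, Finset.sum_sub_distrib, ← Finset.mul_sum, h2, mul_zero] at h1
  linarith

/-- Bound on the error of the regression at `x`, for value functions with values in `[0,1]`. -/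
def MDP.localErr (M : MDP S A H) (D : I → Traj S A H) (h : Fin H) (x : S × A) : ℝ :=
  (M.maxDev D h x + 1) / (1 + visits D h x)

/-- The error is the deviation minus the conditional mean, over `1 + visits`; the second term is the
bias of the regularizer and accounts for the `+ 1` in `MDP.localErr`. -/
theorem MDP.abs_lsviWeight_sub_le (M : MDP S A H) (D : I → Traj S A H) (h : Fin H) (x : S × A)
    {V : S → ℝ} {B : ℝ} (hV : ∀ s, V s ∈ Set.Icc 0 B) :
    |lsviWeight D h V x - M.nextMean h V x| ≤ B * M.localErr D h x := by
  have hB : 0 ≤ B := (hV M.s₁).1.trans (hV M.s₁).2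
  have hn : 0 < 1 + visits D h x := by linarith [visits_nonneg D h x]
  have hm : |M.nextMean h V x| ≤ B := by
    unfold MDP.nextMean
    split_ifs
    · rw [abs_of_nonneg (Finset.sum_nonneg fun s' _ => mul_nonneg (M.P_nonneg _ _ _ _) (hV s').1)]
      calc _ ≤ ∑ s', M.P h x.1 x.2 s' * B :=
            Finset.sum_le_sum fun s' _ => mul_le_mul_of_nonneg_left (hV s').2 (M.P_nonneg _ _ _ _)
        _ = B := by rw [← Finset.sum_mul, M.sum_P, one_mul]
    · simpa using hB
  have hd : M.deviation D h x V = (∑ n, if D n h = x then nextValue (D n) h V else 0) -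
      visits D h x * M.nextMean h V x := by
    unfold MDP.deviation visits
    rw [Finset.sum_mul, ← Finset.sum_sub_distrib]
    refine Finset.sum_congr rfl fun n _ => ?_
    split_ifs <;> simp
  have he : lsviWeight D h V x - M.nextMean h V x =
      (M.deviation D h x V - M.nextMean h V x) / (1 + visits D h x) := by
    rw [lsviWeight_apply, hd]
    field_simp
    ring
  rw [he, abs_div, abs_of_pos hn, MDP.localErr, mul_div_assoc']
  refine div_le_div_of_nonneg_right ?_ hn.le
  linarith [abs_sub (M.deviation D h x V) (M.nextMean h V x), M.abs_deviation_le D h x hV]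

theorem clip_mem_Icc {B : ℝ} (hB : 0 ≤ B) (x : ℝ) : clip B x ∈ Set.Icc 0 B :=
  ⟨le_max_left _ _, max_le hB (min_le_right _ _)⟩

theorem abs_clip_sub_le {B x y : ℝ} (hy : y ∈ Set.Icc 0 B) : |clip B x - y| ≤ |x - y| := by
  obtain ⟨h0, h1⟩ := hy
  unfold clip
  rcases max_cases 0 (min x B) with h | h <;> rcases min_cases x B with h' | h' <;>
    rw [h.1] <;> try rw [h'.1]
  all_goals rcases abs_cases (x - y) with h2 | h2 <;> rw [h2.1, abs_le] <;> constructor <;>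
    linarith [h.2, h'.2]

theorem feature_dotProduct (x : S × A) (w : S × A → ℝ) : feature x ⬝ᵥ w = w x := by
  simp [feature]

theorem MDP.abs_sum_sub_sum_le (M : MDP S A H) (h : Fin H) (s : S) (a : A) (U V : S → ℝ) :
    |∑ s', M.P h s a s' * U s' - ∑ s', M.P h s a s' * V s'| ≤
      ∑ s', M.P h s a s' * |U s' - V s'| := by
  rw [← Finset.sum_sub_distrib]
  refine (Finset.abs_sum_le_sum_abs _ _).trans (Finset.sum_le_sum fun s' _ => ?_)
  rw [← mul_sub, abs_mul, abs_of_nonneg (M.P_nonneg _ _ _ _)]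

theorem evV_of_lt (D : I → Traj S A H) (π : DetPolicy S A H) (r : Reward S A H) {j : ℕ}
    (hj : j < H) (s : S) : evV D π r j s =
      clip H (lsviWeight D ⟨j, hj⟩ (evV D π r (j + 1)) (s, π ⟨j, hj⟩ s) +
        r ⟨j, hj⟩ s (π ⟨j, hj⟩ s)) := by
  rw [evV, dif_pos hj]
  simp only [feature_dotProduct]

theorem evV_of_le (D : I → Traj S A H) (π : DetPolicy S A H) (r : Reward S A H) {j : ℕ}
    (hj : H ≤ j) : evV D π r j = 0 := by
  rw [evV, dif_neg (not_lt.2 hj)]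

theorem evV_mem_Icc (D : I → Traj S A H) (π : DetPolicy S A H) (r : Reward S A H) (j : ℕ) (s : S) :
    evV D π r j s ∈ Set.Icc 0 (H : ℝ) := by
  rcases lt_or_ge j H with hj | hj
  · rw [evV_of_lt _ _ _ hj]
    exact clip_mem_Icc (Nat.cast_nonneg _) _
  · rw [evV_of_le _ _ _ hj]
    simp

/-- The regression error is charged to the value function actually computed, which depends on the
data. This is harmless because `MDP.localErr` is uniform over all functions with values in `[0,H]`;
truncation only brings the estimate closer to the true value. -/
theorem MDP.abs_estimateV_sub_value_le (M : MDP S A H) (D : I → Traj S A H)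
    (π : DetPolicy S A H) (r : Reward S A H) (hr : IsValidReward r) :
    |estimateV D M.s₁ π r - M.value (DetPolicy.toPolicy π) r| ≤
      M.value (DetPolicy.toPolicy π) fun j s a => H * M.localErr D j (s, a) := by
  refine M.abs_sub_value_le π r _ (evV D π r) (evV_of_le _ _ _ le_rfl) fun j s => ?_
  rw [evV_of_lt _ _ _ j.isLt]
  refine (abs_clip_sub_le (M.detVal_mem_Icc π r hr j s)).trans ?_
  rw [M.detVal_of_lt π r j.isLt]
  have hmean : M.nextMean j (evV D π r (j + 1)) (s, π j s) =
      ∑ s', M.P j s (π j s) s' * evV D π r (j + 1) s' := by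
    unfold MDP.nextMean
    split_ifs with hj
    · rfl
    · rw [evV_of_le _ _ _ (not_lt.1 hj)]
      simp
  have h1 := M.abs_lsviWeight_sub_le D j (s, π j s) (evV_mem_Icc D π r (j + 1))
  have h2 := M.abs_sum_sub_sum_le j s (π j s) (evV D π r (j + 1)) (M.detVal π r (j + 1))
  rw [hmean] at h1
  have h3 := abs_add_le
    (lsviWeight D j (evV D π r (j + 1)) (s, π j s) -
      ∑ s', M.P j s (π j s) s' * evV D π r (j + 1) s')
    (∑ s', M.P j s (π j s) s' * evV D π r (j + 1) s' -
      ∑ s', M.P j s (π j s) s' * M.detVal π r (j + 1) s')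
  refine le_trans (le_of_eq ?_) (h3.trans (add_le_add h1 h2))
  congr 1
  simp only [Fin.eta]
  ring

theorem erV_of_lt (D : I → Traj S A H) (π : DetPolicy S A H) (r : S → A → ℝ) (B : ℝ) (h : Fin H)
    {j : ℕ} (hj : j < h.val) (s : S) : erV D π r B h j s =
      clip B (lsviWeight D ⟨j, hj.trans h.isLt⟩ (erV D π r B h (j + 1))
        (s, π ⟨j, hj.trans h.isLt⟩ s)) := by
  rw [erV, dif_pos hj]
  simp only [feature_dotProduct]

theorem erV_self (D : I → Traj S A H) (π : DetPolicy S A H) (r : S → A → ℝ) (B : ℝ) (h : Fin H)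
    (s : S) : erV D π r B h h s = r s (π h s) := by
  rw [erV, dif_neg (lt_irrefl _)]

theorem erV_mem_Icc (D : I → Traj S A H) (π : DetPolicy S A H) (r : S → A → ℝ) {B : ℝ}
    (hr : ∀ s a, r s a ∈ Set.Icc 0 B) (h : Fin H) (j : ℕ) (s : S) :
    erV D π r B h j s ∈ Set.Icc 0 B := by
  by_cases hj : j < h.val
  · rw [erV_of_lt _ _ _ _ _ hj]
    have := hr s (π h s)
    exact clip_mem_Icc (this.1.trans this.2) _
  · rw [erV, dif_neg hj]
    exact hr _ _

theorem estOcc_mem_Icc (D : I → Traj S A H) (s₁ : S) (h : Fin H) (π : DetPolicy S A H)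
    (x : S × A) : estOcc D s₁ h π x ∈ Set.Icc (0 : ℝ) 1 :=
  erV_mem_Icc D π _ (fun s a => by split_ifs <;> simp) h 0 s₁

/-- Only layers strictly before `h` contribute, since the indicator reward at layer `h` is known
exactly. This is what lets the design of layer `h` rely on earlier deployments alone. -/
theorem MDP.abs_estOcc_sub_occ_le (M : MDP S A H) (D : I → Traj S A H) (h : Fin H)
    (π : DetPolicy S A H) (x : S × A) :
    |estOcc D M.s₁ h π x - M.occ (DetPolicy.toPolicy π) h x| ≤
      M.value (DetPolicy.toPolicy π) fun j s a => if j < h then M.localErr D j (s, a) else 0 := by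
  set q : S → A → ℝ := fun s a => if (s, a) = x then 1 else 0 with hq
  set r : Reward S A H := fun j s a => if j = h ∧ (s, a) = x then 1 else 0 with hr
  have hq01 : ∀ s a, q s a ∈ Set.Icc (0 : ℝ) 1 := fun s a => by
    simp only [hq]
    split_ifs <;> simp
  have hgt : ∀ i j, i + j = H → h.val < j → M.detVal π r j = 0 := by
    intro i
    induction i with
    | zero => exact fun j hj _ => M.detVal_of_le _ _ (by omega)
    | succ i ih =>
      intro j hj hlt
      funext s
      rw [M.detVal_of_lt π r (show j < H by omega), ih (j + 1) (by omega) (by omega)]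
      have : (⟨j, by omega⟩ : Fin H) ≠ h := fun h' => by simp [← h'] at hlt
      simp [hr, this]
  have hself : ∀ s, M.detVal π r h s = q s (π h s) := by
    intro s
    rw [M.detVal_of_lt π r h.isLt, hgt (H - (h + 1)) (h + 1) (by omega) (by omega)]
    simp [hr, hq]
  have hlt : ∀ j (hj : j < h.val), ∀ s, M.detVal π r j s =
      ∑ s', M.P ⟨j, hj.trans h.isLt⟩ s (π ⟨j, hj.trans h.isLt⟩ s) s' *
        M.detVal π r (j + 1) s' := by
    intro j hj s
    rw [M.detVal_of_lt π r (hj.trans h.isLt)]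
    have : (⟨j, hj.trans h.isLt⟩ : Fin H) ≠ h := fun h' => by simp [← h'] at hj
    simp [hr, this]
  have h01 : ∀ i j, i + j = h.val → ∀ s, M.detVal π r j s ∈ Set.Icc (0 : ℝ) 1 := by
    intro i
    induction i with
    | zero =>
      intro j hj s
      rw [show j = h.val by omega, hself]
      exact hq01 _ _
    | succ i ih =>
      intro j hj s
      rw [hlt j (by omega)]
      refine ⟨Finset.sum_nonneg fun s' _ => mul_nonneg (M.P_nonneg _ _ _ _)
        (ih (j + 1) (by omega) s').1, ?_⟩
      calc _ ≤ ∑ s', M.P ⟨j, by omega⟩ s (π ⟨j, by omega⟩ s) s' * (1 : ℝ) :=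
            Finset.sum_le_sum fun s' _ => mul_le_mul_of_nonneg_left
              (ih (j + 1) (by omega) s').2 (M.P_nonneg _ _ _ _)
        _ = 1 := by rw [← Finset.sum_mul, M.sum_P, one_mul]
  rw [M.occ_eq_value]
  have key := M.abs_sub_value_le π r
    (fun j s a => if j < h then M.localErr D j (s, a) else 0)
    -- Beyond layer `h` the recursion `erV` returns its reward rather than `0`, so it is cut off
    -- there.
    (fun j s => if j ≤ h.val then erV D π q 1 h j s else 0)
    (by funext s; simp [not_le.2 h.isLt]) ?_
  · simpa [estOcc, estimateER] using key
  intro j s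
  rcases lt_trichotomy j h with hj | hj | hj
  · have hjv : j.val < h.val := hj
    rw [if_pos hj, if_pos hjv.le, erV_of_lt _ _ _ _ _ hjv]
    have h1 := M.abs_lsviWeight_sub_le D j (s, π j s) (erV_mem_Icc D π q hq01 h (j + 1))
    have h2 := M.abs_sum_sub_sum_le j s (π j s) (erV D π q 1 h (j + 1)) (M.detVal π r (j + 1))
    refine (abs_clip_sub_le (h01 (h - j) j (by omega) s)).trans ?_
    simp only [if_pos (show j.val + 1 ≤ h.val by omega)]
    rw [MDP.nextMean, if_pos (by omega)] at h1
    rw [hlt j hjv]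
    have h3 := abs_add_le
      (lsviWeight D j (erV D π q 1 h (j + 1)) (s, π j s) -
        ∑ s', M.P j s (π j s) s' * erV D π q 1 h (j + 1) s')
      (∑ s', M.P j s (π j s) s' * erV D π q 1 h (j + 1) s' -
        ∑ s', M.P j s (π j s) s' * M.detVal π r (j + 1) s')
    rw [one_mul] at h1
    refine le_trans (le_of_eq ?_) (h3.trans (add_le_add h1 h2))
    congr 1
    simp only [Fin.eta]
    ring
  · subst hj
    simp only [le_refl, if_true, erV_self, hself, sub_self, abs_zero, lt_irrefl, if_false,
      zero_add]
    exact Finset.sum_nonneg fun s' _ => mul_nonneg (M.P_nonneg _ _ _ _) (abs_nonneg _)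
  · have hjv : h.val < j.val := hj
    rw [if_neg (not_le.2 hjv), hgt (H - j) j (by omega) hjv, if_neg (not_lt.2 hj.le)]
    simp only [Pi.zero_apply, sub_self, abs_zero, zero_add]
    exact Finset.sum_nonneg fun s' _ => mul_nonneg (M.P_nonneg _ _ _ _) (abs_nonneg _)

end EstimationError

/-! ### Optimal designs by maximizing a product -/

section Design

/-- First-order condition at a maximizer of a product of affine functions. -/
theorem sum_div_le_card_of_prod_le {X : Type*} (s : Finset X) (a b : X → ℝ)
    (ha : ∀ x ∈ s, 0 < a x) (hb : ∀ x ∈ s, 0 ≤ b x)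
    (h : ∀ t ∈ Set.Ioo (0 : ℝ) 1, ∏ x ∈ s, ((1 - t) * a x + t * b x) ≤ ∏ x ∈ s, a x) :
    ∑ x ∈ s, b x / a x ≤ s.card := by
  set c : X → ℝ := fun x => b x / a x - 1 with hc
  have hpos : ∀ t ∈ Set.Ioo (0 : ℝ) 1, ∀ x ∈ s, 0 < 1 + t * c x := by
    intro t ht x hx
    have : 0 ≤ b x / a x := div_nonneg (hb x hx) (ha x hx).le
    have h1 : 0 ≤ t * (b x / a x) := mul_nonneg ht.1.le this
    simp only [hc]
    nlinarith [ht.2]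
  have hsum : ∀ t ∈ Set.Ioo (0 : ℝ) 1, ∑ x ∈ s, c x / (1 + t * c x) ≤ 0 := by
    intro t ht
    have hprod : ∏ x ∈ s, (1 + t * c x) ≤ 1 := by
      have h1 := h t ht
      have h2 : ∏ x ∈ s, ((1 - t) * a x + t * b x) =
          (∏ x ∈ s, a x) * ∏ x ∈ s, (1 + t * c x) := by
        rw [← Finset.prod_mul_distrib]
        refine Finset.prod_congr rfl fun x hx => ?_
        have := (ha x hx).ne'
        simp only [hc]
        field_simp
        ring
      rw [h2] at h1
      exact le_of_mul_le_mul_left (by simpa using h1) (Finset.prod_pos ha)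
    have hlog : ∑ x ∈ s, Real.log (1 + t * c x) ≤ 0 := by
      rw [← Real.log_prod fun x hx => (hpos t ht x hx).ne']
      exact Real.log_nonpos (Finset.prod_nonneg fun x hx => (hpos t ht x hx).le) hprod
    -- The inequality `1 - 1 / y ≤ log y` at `y = 1 + t c` bounds the sum for each `t`; letting `t`
    -- tend to 0 then replaces differentiation of the log-product.
    have h3 : t * ∑ x ∈ s, c x / (1 + t * c x) ≤ 0 := by
      refine le_trans ?_ hlog
      rw [Finset.mul_sum]
      refine Finset.sum_le_sum fun x hx => ?_
      have hp := hpos t ht x hx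
      have := Real.one_sub_inv_le_log_of_pos hp
      refine le_trans (le_of_eq ?_) this
      field_simp
      ring
    by_contra! hcon
    exact absurd h3 (not_le.2 (mul_pos ht.1 hcon))
  have hlim : Filter.Tendsto (fun t : ℝ => ∑ x ∈ s, c x / (1 + t * c x))
      (nhdsWithin 0 (Set.Ioi 0)) (nhds (∑ x ∈ s, c x / (1 + 0 * c x))) := by
    refine tendsto_finsetSum _ fun x _ => ?_
    have : ContinuousAt (fun t : ℝ => c x / (1 + t * c x)) 0 :=
      ContinuousAt.div (by fun_prop) (by fun_prop) (by simp)
    exact this.tendsto.mono_left nhdsWithin_le_nhds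
  have hle : ∑ x ∈ s, c x / (1 + 0 * c x) ≤ 0 :=
    le_of_tendsto hlim (Filter.eventually_of_mem (Ioo_mem_nhdsGT one_pos) hsum)
  simp only [hc, zero_mul, add_zero, div_one, Finset.sum_sub_distrib, Finset.sum_const,
    nsmul_eq_mul, mul_one] at hle
  linarith

variable {ρ X : Type*} [Fintype ρ]

/-- Mixture of the rows of `d` with weights `w`. -/
def mixRow (d : ρ → X → ℝ) (w : stdSimplex ℝ ρ) (x : X) : ℝ := ∑ i, w.1 i * d i x

theorem continuous_mixRow (d : ρ → X → ℝ) (x : X) : Continuous fun w => mixRow d w x := by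
  unfold mixRow
  refine continuous_finsetSum _ fun i _ => Continuous.mul ?_ continuous_const
  exact (continuous_apply i).comp continuous_subtype_val

theorem mixRow_nonneg {d : ρ → X → ℝ} (hd : ∀ i x, 0 ≤ d i x) (w : stdSimplex ℝ ρ) (x : X) :
    0 ≤ mixRow d w x :=
  Finset.sum_nonneg fun i _ => mul_nonneg (w.2.1 i) (hd i x)

/-- Convex combination of two mixtures. -/
def blend {t : ℝ} (ht : t ∈ Set.Icc (0 : ℝ) 1) (u v : stdSimplex ℝ ρ) : stdSimplex ℝ ρ :=
  ⟨(1 - t) • u.1 + t • v.1, convex_stdSimplex ℝ ρ u.2 v.2 (by linarith [ht.2]) ht.1 (by ring)⟩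

theorem mixRow_blend (d : ρ → X → ℝ) {t : ℝ} (ht : t ∈ Set.Icc (0 : ℝ) 1) (u v : stdSimplex ℝ ρ)
    (x : X) : mixRow d (blend ht u v) x = (1 - t) * mixRow d u x + t * mixRow d v x := by
  simp only [mixRow, blend, Finset.mul_sum, ← Finset.sum_add_distrib, Pi.add_apply, Pi.smul_apply,
    smul_eq_mul]
  exact Finset.sum_congr rfl fun i _ => by ring

theorem mixRow_vertex [DecidableEq ρ] (d : ρ → X → ℝ) (i : ρ) (x : X) :
    mixRow d ⟨Pi.single i 1, single_mem_stdSimplex ℝ i⟩ x = d i x := by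
  simp [mixRow, Pi.single_apply]

/-- An optimal design: the ratio of every row to the optimal mixture sums to at most the number
of columns. -/
theorem exists_mixRow_sum_div_le [DecidableEq ρ] (d : ρ → X → ℝ) (hd : ∀ i x, 0 ≤ d i x)
    (s : Finset X) (u : stdSimplex ℝ ρ) (hu : ∀ x ∈ s, 0 < mixRow d u x) :
    ∃ w : stdSimplex ℝ ρ, (∀ x ∈ s, 0 < mixRow d w x) ∧
      ∀ i, ∑ x ∈ s, d i x / mixRow d w x ≤ s.card := by
  have hcomp : CompactSpace (stdSimplex ℝ ρ) :=
    isCompact_iff_compactSpace.1 (isCompact_stdSimplex ℝ ρ)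
  -- This is D-optimality for diagonal information matrices. The mixture `u` ensures that the
  -- maximum is positive, and moving towards a vertex gives the bound for that row.
  obtain ⟨w, -, hw⟩ := isCompact_univ.exists_isMaxOn (⟨u, Set.mem_univ u⟩ : Set.univ.Nonempty)
    (continuous_finsetProd s fun x _ => continuous_mixRow d x).continuousOn
  have hmax : ∀ v, ∏ x ∈ s, mixRow d v x ≤ ∏ x ∈ s, mixRow d w x := fun v => hw (Set.mem_univ v)
  have hpos : ∀ x ∈ s, 0 < mixRow d w x := by
    intro x hx
    refine lt_of_le_of_ne (mixRow_nonneg hd w x) fun h0 => ?_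
    have h1 := hmax u
    rw [Finset.prod_eq_zero hx h0.symm] at h1
    exact absurd h1 (not_le.2 (Finset.prod_pos hu))
  refine ⟨w, hpos, fun i => sum_div_le_card_of_prod_le s _ _ hpos (fun x _ => hd i x) ?_⟩
  intro t ht
  have := hmax (blend (Set.Ioo_subset_Icc_self ht) w
    ⟨Pi.single i 1, single_mem_stdSimplex ℝ i⟩)
  simpa only [mixRow_blend, mixRow_vertex] using this

/-- The exploration rule is constrained only when a minimizer exists. The lower bound `θ > 0` keeps
the denominators away from zero, so the objective is continuous on a compact set. -/
theorem exists_design_minimizer [Nonempty ρ] (d : ρ → X → ℝ) (s : Finset X) {θ : ℝ} (hθ : 0 < θ)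
    (u : stdSimplex ℝ ρ) (hu : ∀ x ∈ s, θ ≤ mixRow d u x) :
    ∃ w : stdSimplex ℝ ρ, (∀ x ∈ s, θ ≤ mixRow d w x) ∧
      ∀ v : stdSimplex ℝ ρ, (∀ x ∈ s, θ ≤ mixRow d v x) →
        (⨆ i, ∑ x ∈ s, d i x / mixRow d w x) ≤ ⨆ i, ∑ x ∈ s, d i x / mixRow d v x := by
  have hcomp : CompactSpace (stdSimplex ℝ ρ) :=
    isCompact_iff_compactSpace.1 (isCompact_stdSimplex ℝ ρ)
  have hclosed : IsClosed {w : stdSimplex ℝ ρ | ∀ x ∈ s, θ ≤ mixRow d w x} := by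
    simp only [Set.ofPred_forall]
    exact isClosed_iInter fun x => isClosed_iInter fun _ =>
      isClosed_le continuous_const (continuous_mixRow d x)
  have hcont : ContinuousOn (fun w => ⨆ i, ∑ x ∈ s, d i x / mixRow d w x)
      {w : stdSimplex ℝ ρ | ∀ x ∈ s, θ ≤ mixRow d w x} := by
    simp only [← Finset.sup'_univ_eq_ciSup]
    refine ContinuousOn.finset_sup'_apply _ fun i _ => ?_
    refine continuousOn_finsetSum _ fun x hx => ?_
    exact continuousOn_const.div (continuous_mixRow d x).continuousOn
      fun w hw => (hθ.trans_le (hw x hx)).ne'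
  obtain ⟨w, hw, hmin⟩ := hclosed.isCompact.exists_isMinOn ⟨u, hu⟩ hcont
  exact ⟨w, hw, fun v hv => hmin hv⟩

variable {S A : Type*} [Fintype S] [DecidableEq S] [Fintype A] [DecidableEq A] {H : ℕ}
variable {I : Type*} [Fintype I]

theorem card_layerPairs_le (s₁ : S) (h : Fin H) :
    (layerPairs (A := A) s₁ h).card ≤ Fintype.card S * Fintype.card A := by
  refine (Finset.card_le_univ _).trans_eq ?_
  rw [Fintype.card_prod]

theorem exists_isDesignSolution [Nonempty A] (D : I → Traj S A H) (s₁ : S) {θ : ℝ} (hθ : 0 < θ)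
    (h : Fin H) (u : Mixture S A H) (hu : IsFeasible D s₁ θ h u) :
    ∃ w, IsDesignSolution D s₁ θ h w := by
  obtain ⟨w, hw, hmin⟩ := exists_design_minimizer (estOcc D s₁ h) (layerPairs s₁ h) hθ u hu
  exact ⟨w, hw, hmin⟩

/-- Compare with the midpoint of the unconstrained optimal design `v` and of `u`: it has at least
half of `u`, so it is feasible at `θ`, and at least half of `v`, so its ratios are at most doubled.
-/
theorem IsDesignSolution.sum_div_le [Nonempty A] {D : I → Traj S A H} {s₁ : S} {θ : ℝ}
    (hθ : 0 < θ) {h : Fin H} {w : Mixture S A H} (hw : IsDesignSolution D s₁ θ h w)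
    (u : Mixture S A H) (hu : IsFeasible D s₁ (2 * θ) h u) (π : DetPolicy S A H) :
    ∑ x ∈ layerPairs s₁ h, estOcc D s₁ h π x / estOccMix D s₁ h w x ≤
      2 * (Fintype.card S * Fintype.card A) := by
  have hd : ∀ π x, 0 ≤ estOcc D s₁ h π x := fun π x => (estOcc_mem_Icc D s₁ h π x).1
  obtain ⟨v, hv, hsum⟩ := exists_mixRow_sum_div_le (estOcc D s₁ h) hd (layerPairs s₁ h) u
    fun x hx => lt_of_lt_of_le (by positivity) (hu x hx)
  have ht : (1 / 2 : ℝ) ∈ Set.Icc (0 : ℝ) 1 := by norm_num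
  have hfeas : IsFeasible D s₁ θ h (blend ht v u) := by
    intro x hx
    change θ ≤ mixRow _ _ _
    rw [mixRow_blend]
    have h1 : 2 * θ ≤ mixRow (estOcc D s₁ h) u x := hu x hx
    linarith [(hv x hx).le]
  have hbdd : BddAbove (Set.range fun π : DetPolicy S A H =>
      ∑ x ∈ layerPairs s₁ h, estOcc D s₁ h π x / estOccMix D s₁ h w x) :=
    Set.finite_range _ |>.bddAbove
  refine (le_ciSup hbdd π).trans ((hw.2 _ hfeas).trans (ciSup_le fun π => ?_))
  calc _ ≤ ∑ x ∈ layerPairs s₁ h, 2 * (estOcc D s₁ h π x / mixRow (estOcc D s₁ h) v x) := by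
        refine Finset.sum_le_sum fun x hx => ?_
        change _ / mixRow _ _ _ ≤ _
        have h1 : 2 * θ ≤ mixRow (estOcc D s₁ h) u x := hu x hx
        have h2 := hv x hx
        rw [mixRow_blend, ← mul_div_assoc, div_le_div_iff₀ (by linarith) h2]
        have h3 := mul_nonneg (hd π x) (by linarith : 0 ≤ mixRow (estOcc D s₁ h) u x)
        linarith
    _ ≤ 2 * (Fintype.card S * Fintype.card A) := by
        rw [← Finset.mul_sum]
        have h4 : ((layerPairs (A := A) s₁ h).card : ℝ) ≤ Fintype.card S * Fintype.card A := by
          exact_mod_cast card_layerPairs_le s₁ h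
        linarith [hsum π]

end Design

/-! ### Adaptively collected data and Markov's inequality -/

section AdaptiveData

theorem sum_fin_snoc {Y : Type*} [Fintype Y] {m : ℕ} (f : (Fin (m + 1) → Y) → ℝ) :
    ∑ D, f D = ∑ D : Fin m → Y, ∑ y, f (Fin.snoc D y) := by
  rw [← (Fin.snocEquiv fun _ : Fin (m + 1) => Y).sum_comp f, Fintype.sum_prod_type_right]
  rfl

theorem sum_prod_adaptive_succ {Y : Type*} [Fintype Y] {m : ℕ}
    (q : (k : Fin (m + 1)) → (Fin k.val → Y) → Y → ℝ) :
    ∑ D : Fin (m + 1) → Y, ∏ k, q k (fun i => D ⟨i.val, i.isLt.trans k.isLt⟩) (D k) =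
      ∑ D : Fin m → Y, (∏ k : Fin m, q k.castSucc (fun i => D ⟨i.val, i.isLt.trans k.isLt⟩) (D k)) *
        ∑ y, q (Fin.last m) D y := by
  rw [sum_fin_snoc]
  refine Finset.sum_congr rfl fun D _ => ?_
  rw [Finset.mul_sum]
  refine Finset.sum_congr rfl fun y _ => ?_
  rw [Fin.prod_univ_castSucc]
  congr 1
  · refine Finset.prod_congr rfl fun k _ => ?_
    rw [Fin.snoc_castSucc]
    congr 1
    funext i
    have : i.val < m := i.isLt.trans k.isLt
    simp [Fin.snoc, this]
  · rw [Fin.snoc_last]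
    congr 1
    funext i
    have : i.val < m := i.isLt
    simp [Fin.snoc, this]

/-- Sum out the last deployment first: its law depends only on the earlier ones, and its conditional
mass is at most one. -/
theorem sum_prod_adaptive_le_one {Y : Type*} [Fintype Y] {m : ℕ}
    (q : (k : Fin m) → (Fin k.val → Y) → Y → ℝ) (h0 : ∀ k D y, 0 ≤ q k D y)
    (h1 : ∀ k D, ∑ y, q k D y ≤ 1) :
    ∑ D : Fin m → Y, ∏ k, q k (fun i => D ⟨i.val, i.isLt.trans k.isLt⟩) (D k) ≤ 1 := by
  induction m with
  | zero => simp
  | succ m ih =>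
    rw [sum_prod_adaptive_succ]
    refine le_trans (Finset.sum_le_sum fun D _ => ?_)
      (ih (fun k => q k.castSucc) (fun k => h0 k.castSucc) (fun k => h1 k.castSucc))
    exact mul_le_of_le_one_right (Finset.prod_nonneg fun k _ => h0 _ _ _) (h1 _ _)

theorem sum_prod_adaptive_eq_one {Y : Type*} [Fintype Y] {m : ℕ}
    (q : (k : Fin m) → (Fin k.val → Y) → Y → ℝ) (h1 : ∀ k D, ∑ y, q k D y = 1) :
    ∑ D : Fin m → Y, ∏ k, q k (fun i => D ⟨i.val, i.isLt.trans k.isLt⟩) (D k) = 1 := by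
  induction m with
  | zero => simp
  | succ m ih =>
    rw [sum_prod_adaptive_succ, ← ih (fun k => q k.castSucc) (fun k => h1 k.castSucc)]
    refine Finset.sum_congr rfl fun D _ => ?_
    rw [h1, mul_one]
    rfl

theorem sum_prod_eq_pow {X : Type*} [Fintype X] (N : ℕ) (g : X → ℝ) :
    ∑ y : Fin N → X, ∏ n, g (y n) = (∑ x, g x) ^ N := by
  classical
  have := Finset.prod_univ_sum (fun _ : Fin N => (Finset.univ : Finset X)) (fun _ x => g x)
  rw [Fintype.piFinset_univ] at this
  rw [← this]
  simp

variable {S A : Type*} [Fintype S] [DecidableEq S] [Fintype A] [DecidableEq A] {H m N : ℕ}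

theorem Scheme.dataProb_nonneg (alg : Scheme S A H m N) (M : MDP S A H)
    (D : Fin m → Fin N → Traj S A H) : 0 ≤ alg.dataProb M D :=
  Finset.prod_nonneg fun _ _ => Finset.prod_nonneg fun _ _ => M.mixTrajProb_nonneg _ _

theorem Scheme.sum_dataProb (alg : Scheme S A H m N) (M : MDP S A H) :
    ∑ D, alg.dataProb M D = 1 := by
  refine sum_prod_adaptive_eq_one
    (fun k D y => ∏ n : Fin N, M.mixTrajProb (alg.policy k D) (y n)) fun k D => ?_
  rw [sum_prod_eq_pow, M.sum_mixTrajProb, one_pow]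

/-- The data of the first `k` deployments. -/
def takeData (D : Fin m → Fin N → Traj S A H) (k : ℕ) (hk : k ≤ m) :
    Fin k → Fin N → Traj S A H :=
  fun i n => D ⟨i.val, i.isLt.trans_le hk⟩ n

/-- A product of weights of conditional mean at most one has mean at most one. -/
theorem Scheme.sum_dataProb_mul_le_one (alg : Scheme S A H m N) (M : MDP S A H)
    (F : (k : Fin m) → (Fin k.val → Fin N → Traj S A H) → Traj S A H → ℝ)
    (h0 : ∀ k D τ, 0 ≤ F k D τ)
    (h1 : ∀ k D, ∑ τ, M.mixTrajProb (alg.policy k D) τ * F k D τ ≤ 1) :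
    ∑ D, alg.dataProb M D * ∏ k, ∏ n, F k (takeData D k k.isLt.le) (D k n) ≤ 1 := by
  have := sum_prod_adaptive_le_one
    (fun (k : Fin m) (D : Fin k.val → Fin N → Traj S A H) (y : Fin N → Traj S A H) =>
      ∏ n : Fin N, (M.mixTrajProb (alg.policy k D) (y n) * F k D (y n)))
    (fun k D y => Finset.prod_nonneg fun n _ => mul_nonneg (M.mixTrajProb_nonneg _ _) (h0 _ _ _))
    (fun k D => by
      rw [sum_prod_eq_pow N fun τ => M.mixTrajProb (alg.policy k D) τ * F k D τ]
      exact pow_le_one₀ (Finset.sum_nonneg fun τ _ =>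
        mul_nonneg (M.mixTrajProb_nonneg _ _) (h0 _ _ _)) (h1 k D))
  simp only [Finset.prod_mul_distrib] at this
  exact this

/-- Markov's inequality for a product of weights of conditional mean at most one. -/
theorem Scheme.prob_le_of_le_prod (alg : Scheme S A H m N) (M : MDP S A H)
    (F : (k : Fin m) → (Fin k.val → Fin N → Traj S A H) → Traj S A H → ℝ)
    (h0 : ∀ k D τ, 0 ≤ F k D τ)
    (h1 : ∀ k D, ∑ τ, M.mixTrajProb (alg.policy k D) τ * F k D τ ≤ 1)
    (E : Set (Fin m → Fin N → Traj S A H)) {u : ℝ}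
    (hE : ∀ D ∈ E, Real.exp u ≤ ∏ k, ∏ n, F k (takeData D k k.isLt.le) (D k n)) :
    alg.prob M E ≤ Real.exp (-u) := by
  have h := alg.sum_dataProb_mul_le_one M F h0 h1
  have h2 : alg.prob M E ≤ Real.exp (-u) *
      ∑ D, alg.dataProb M D * ∏ k, ∏ n, F k (takeData D k k.isLt.le) (D k n) := by
    rw [Scheme.prob, Finset.mul_sum]
    refine Finset.sum_le_sum fun D _ => ?_
    have hp := alg.dataProb_nonneg M D
    by_cases hD : D ∈ E
    · rw [Set.indicator_of_mem hD, mul_left_comm]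
      refine le_mul_of_one_le_right hp ?_
      calc (1 : ℝ) = Real.exp (-u) * Real.exp u := by rw [← Real.exp_add]; simp
        _ ≤ _ := mul_le_mul_of_nonneg_left (hE D hD) (Real.exp_nonneg _)
    · rw [Set.indicator_of_notMem hD]
      exact mul_nonneg (Real.exp_nonneg _) (mul_nonneg hp
        (Finset.prod_nonneg fun _ _ => Finset.prod_nonneg fun _ _ => h0 _ _ _))
  exact h2.trans (mul_le_of_le_one_right (Real.exp_nonneg _) h)

theorem Scheme.prob_mono (alg : Scheme S A H m N) (M : MDP S A H)
    {E E' : Set (Fin m → Fin N → Traj S A H)} (h : E ⊆ E') : alg.prob M E ≤ alg.prob M E' :=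
  Finset.sum_le_sum fun _ _ =>
    Set.indicator_le_indicator_of_subset h (fun D => alg.dataProb_nonneg M D) _

theorem Scheme.prob_iUnion_le (alg : Scheme S A H m N) (M : MDP S A H) {J : Type*} [Fintype J]
    (E : J → Set (Fin m → Fin N → Traj S A H)) :
    alg.prob M (⋃ i, E i) ≤ ∑ i, alg.prob M (E i) := by
  unfold Scheme.prob
  rw [Finset.sum_comm]
  refine Finset.sum_le_sum fun D _ => ?_
  have h0 : ∀ i, 0 ≤ (E i).indicator (alg.dataProb M) D :=
    fun i => Set.indicator_nonneg (fun D _ => alg.dataProb_nonneg M D) D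
  by_cases hD : D ∈ ⋃ i, E i
  · obtain ⟨i, hi⟩ := Set.mem_iUnion.1 hD
    rw [Set.indicator_of_mem hD]
    calc alg.dataProb M D = (E i).indicator (alg.dataProb M) D := (Set.indicator_of_mem hi _).symm
      _ ≤ _ := Finset.single_le_sum (f := fun i => (E i).indicator (alg.dataProb M) D)
          (fun i _ => h0 i) (Finset.mem_univ i)
  · rw [Set.indicator_of_notMem hD]
    exact Finset.sum_nonneg fun i _ => h0 i

theorem Scheme.one_sub_le_prob (alg : Scheme S A H m N) (M : MDP S A H)
    {E B₁ B₂ : Set (Fin m → Fin N → Traj S A H)} (h : ∀ D, D ∉ B₁ → D ∉ B₂ → D ∈ E) :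
    1 - (alg.prob M B₁ + alg.prob M B₂) ≤ alg.prob M E := by
  rw [← alg.sum_dataProb M]
  unfold Scheme.prob
  rw [sub_le_iff_le_add, ← Finset.sum_add_distrib, ← Finset.sum_add_distrib]
  refine Finset.sum_le_sum fun D _ => ?_
  have hp := alg.dataProb_nonneg M D
  have h0 : ∀ B : Set (Fin m → Fin N → Traj S A H), 0 ≤ B.indicator (alg.dataProb M) D :=
    fun B => Set.indicator_nonneg (fun D _ => alg.dataProb_nonneg M D) D
  by_cases h1 : D ∈ B₁
  · linarith [Set.indicator_of_mem h1 (alg.dataProb M), h0 E, h0 B₂]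
  · by_cases h2 : D ∈ B₂
    · linarith [Set.indicator_of_mem h2 (alg.dataProb M), h0 E, h0 B₁]
    · linarith [Set.indicator_of_mem (h D h1 h2) (alg.dataProb M), h0 B₁, h0 B₂]

end AdaptiveData

/-! ### Exponential supermartingales for visits and transitions -/

section Concentration

variable {S A : Type*} [Fintype S] [DecidableEq S] [Fintype A] [DecidableEq A] {H m N : ℕ}

theorem log_two_le : Real.log 2 ≤ 3 / 4 := by linarith [Real.log_two_lt_d9]

/-- Lower tail of the number of visits in one deployment. -/
theorem Scheme.prob_visits_lt (alg : Scheme S A H m N) (M : MDP S A H) (k : Fin m) (h : Fin H)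
    (x : S × A) (q : ℝ) :
    alg.prob M {D | q ≤ M.mixOcc (alg.deployed D k) h x ∧
      visits (D k) h x < N * M.mixOcc (alg.deployed D k) h x / 2} ≤ Real.exp (-(N * q / 8)) := by
  -- Chernoff weight `exp (p / 2)`, halved on a visit: its mean is `exp (p / 2) * (1 - p / 2) ≤ 1`.
  -- Other deployments have weight 1.
  set F : (k' : Fin m) → (Fin k'.val → Fin N → Traj S A H) → Traj S A H → ℝ := fun k' D τ =>
    if k' = k then Real.exp (M.mixOcc (alg.policy k' D) h x / 2 -
      if τ h = x then Real.log 2 else 0) else 1 with hF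
  refine alg.prob_le_of_le_prod M F ?_ ?_ _ ?_
  · intro k' D τ
    simp only [hF]
    split_ifs <;> positivity
  · intro k' D
    by_cases hk : k' = k
    · simp only [hF, if_pos hk]
      set w := alg.policy k' D
      set p := M.mixOcc w h x with hp
      have h1 : ∀ τ : Traj S A H, M.mixTrajProb w τ *
          Real.exp (p / 2 - if τ h = x then Real.log 2 else 0) =
          Real.exp (p / 2) * (M.mixTrajProb w τ -
            (if τ h = x then M.mixTrajProb w τ else 0) / 2) := by
        intro τ
        rw [Real.exp_sub]
        split_ifs
        · rw [Real.exp_log two_pos]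
          ring
        · simp [mul_comm]
      simp only [h1, ← Finset.mul_sum, Finset.sum_sub_distrib, ← Finset.sum_div,
        ← M.mixOcc_eq, M.sum_mixTrajProb]
      have h2 : 1 - p / 2 ≤ Real.exp (-(p / 2)) := by linarith [Real.add_one_le_exp (-(p / 2))]
      calc Real.exp (p / 2) * (1 - p / 2) ≤ Real.exp (p / 2) * Real.exp (-(p / 2)) :=
            mul_le_mul_of_nonneg_left h2 (Real.exp_nonneg _)
        _ = 1 := by rw [← Real.exp_add]; simp
    · simp [hF, hk, M.sum_mixTrajProb]
  · rintro D ⟨hq, hlt⟩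
    set p := M.mixOcc (alg.deployed D k) h x with hp
    have hprod : ∏ k', ∏ n, F k' (takeData D k' k'.isLt.le) (D k' n) =
        Real.exp (N * (p / 2) - visits (D k) h x * Real.log 2) := by
      rw [Finset.prod_eq_single k]
      · simp only [hF, if_true]
        rw [← Real.exp_sum, Finset.sum_sub_distrib]
        congr 2
        · have hp' : M.mixOcc (alg.policy k (takeData D k k.isLt.le)) h x = p := rfl
          simp [hp']
        · simp only [visits, Finset.sum_mul, ite_mul, one_mul, zero_mul]
      · intro k' _ hk'
        simp [hF, hk']
      · simp
    rw [hprod]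
    refine Real.exp_le_exp.2 ?_
    -- With `log 2 ≤ 3 / 4`, the exponent keeps at least `N p / 2 - 3 N p / 8 = N p / 8`.
    have h3 : visits (D k) h x * Real.log 2 ≤ N * p / 2 * (3 / 4) :=
      mul_le_mul hlt.le log_two_le (Real.log_nonneg one_le_two)
        ((visits_nonneg _ _ _).trans hlt.le)
    have h4 : (N : ℝ) * q ≤ N * p := mul_le_mul_of_nonneg_left hq (Nat.cast_nonneg _)
    linarith

/-- Since `exp y ≤ 1 + y + y ^ 2` for `|y| ≤ 1` and the centred term has mean zero, the mean is at
most `(1 + l ^ 2) * exp (-l ^ 2)`. -/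
theorem sum_mul_exp_le_one {p : S → ℝ} (hp : p ∈ stdSimplex ℝ S) (T : Finset S) {l : ℝ}
    (h0 : 0 ≤ l) (h1 : l ≤ 1) :
    ∑ s, p s * Real.exp (l * (stateInd T s - ∑ s', p s' * stateInd T s') - l ^ 2) ≤ 1 := by
  set μ := ∑ s', p s' * stateInd T s' with hμ
  have hind : ∀ s, stateInd T s ∈ Set.Icc (0 : ℝ) 1 := fun s => by
    unfold stateInd
    split_ifs <;> simp
  have hμ0 : 0 ≤ μ := Finset.sum_nonneg fun s _ => mul_nonneg (hp.1 s) (hind s).1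
  have hμ1 : μ ≤ 1 := by
    rw [← hp.2]
    exact Finset.sum_le_sum fun s _ => mul_le_of_le_one_right (hp.1 s) (hind s).2
  have hexp : ∀ s, Real.exp (l * (stateInd T s - μ)) ≤ 1 + l * (stateInd T s - μ) + l ^ 2 := by
    intro s
    have hX : |stateInd T s - μ| ≤ 1 :=
      abs_le.2 ⟨by linarith [(hind s).1], by linarith [(hind s).2]⟩
    have hy : |l * (stateInd T s - μ)| ≤ l := by
      rw [abs_mul, abs_of_nonneg h0]
      exact mul_le_of_le_one_right h0 hX
    have h2 := (abs_le.1 (Real.abs_exp_sub_one_sub_id_le (hy.trans h1))).2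
    have h3 : (l * (stateInd T s - μ)) ^ 2 ≤ l ^ 2 := by
      rw [← sq_abs]
      exact pow_le_pow_left₀ (abs_nonneg _) hy 2
    linarith
  calc ∑ s, p s * Real.exp (l * (stateInd T s - μ) - l ^ 2)
      ≤ ∑ s, p s * ((1 + l * (stateInd T s - μ) + l ^ 2) * Real.exp (-l ^ 2)) := by
        refine Finset.sum_le_sum fun s _ => mul_le_mul_of_nonneg_left ?_ (hp.1 s)
        rw [sub_eq_add_neg, Real.exp_add]
        exact mul_le_mul_of_nonneg_right (hexp s) (Real.exp_nonneg _)
    _ = (1 + l ^ 2) * Real.exp (-l ^ 2) := by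
        simp only [← mul_assoc, ← Finset.sum_mul]
        congr 1
        have : ∀ s, p s * (1 + l * (stateInd T s - μ) + l ^ 2) =
            (1 + l ^ 2 - l * μ) * p s + l * (p s * stateInd T s) := fun s => by ring
        simp only [this, Finset.sum_add_distrib, ← Finset.mul_sum, hp.2, ← hμ]
        ring
    _ ≤ Real.exp (l ^ 2) * Real.exp (-l ^ 2) :=
        mul_le_mul_of_nonneg_right (by linarith [Real.add_one_le_exp (l ^ 2)]) (Real.exp_nonneg _)
    _ = 1 := by rw [← Real.exp_add]; simp

/-- Exponent of the transition supermartingale: in layer `j` it follows the event that the next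
state lies in `T j` after a visit of `x j`, with inverse temperature `l j`. -/
def MDP.score (M : MDP S A H) (x : Fin H → S × A) (T : Fin H → Finset S) (l : Fin H → ℝ)
    (τ : Traj S A H) : ℝ :=
  ∑ j, if τ j = x j then l j * (nextValue τ j (stateInd (T j)) -
    M.nextMean j (stateInd (T j)) (x j)) - l j ^ 2 else 0

theorem MDP.expect_exp_score_le_one (M : MDP S A H) (π : Policy S A H) (x : Fin H → S × A)
    (T : Fin H → Finset S) {l : Fin H → ℝ} (h0 : ∀ j, 0 ≤ l j) (h1 : ∀ j, l j ≤ 1) :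
    M.expect π (fun τ => Real.exp (M.score x T l τ)) ≤ 1 := by
  set G : Fin H → S × A → S → ℝ := fun j y s => Real.exp (if y = x j then
    l j * (stateInd (T j) s - ∑ s', M.P j (x j).1 (x j).2 s' * stateInd (T j) s') - l j ^ 2
    else 0) with hG
  refine le_trans (M.expect_mono π fun τ => ?_)
    (M.expect_transProd_le_one π G (fun j y s => Real.exp_nonneg _) fun j y => ?_)
  · rw [MDP.score, Real.exp_sum, transProd]
    refine Finset.prod_le_prod (fun j _ => Real.exp_nonneg _) fun j _ => ?_
    by_cases hj : j.val + 1 < H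
    · simp [hG, hj, nextValue, MDP.nextMean]
    -- In the last layer the deviation vanishes and the score is `-l ^ 2` or `0`, against a factor 1
    -- in `transProd`.
    · simp only [hj, nextValue, MDP.nextMean, dif_neg, if_neg, not_false_eq_true, sub_zero,
        mul_zero, zero_sub]
      rw [Real.exp_le_one_iff]
      split_ifs
      · linarith [sq_nonneg (l j)]
      · exact le_rfl
  · by_cases hy : y = x j
    · subst hy
      simpa [hG] using sum_mul_exp_le_one (M.P_mem j (x j).1 (x j).2) (T j) (h0 j) (h1 j)
    · simp [hG, hy, M.sum_P]

theorem MDP.sum_score_pool (M : MDP S A H) {k : ℕ} (D : Fin k → Fin N → Traj S A H)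
    (x : Fin H → S × A) (T : Fin H → Finset S) (l : Fin H → ℝ) :
    ∑ i, ∑ n, M.score x T l (D i n) =
      ∑ j, (l j * M.deviation (pool D) j (x j) (stateInd (T j)) -
        l j ^ 2 * visits (pool D) j (x j)) := by
  rw [← Fintype.sum_prod_type' fun i n => M.score x T l (D i n)]
  change ∑ p, M.score x T l (pool D p) = _
  unfold MDP.score MDP.deviation visits
  rw [Finset.sum_comm]
  refine Finset.sum_congr rfl fun j _ => ?_
  rw [Finset.mul_sum, Finset.mul_sum, ← Finset.sum_sub_distrib]
  refine Finset.sum_congr rfl fun p _ => ?_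
  split_ifs <;> simp

theorem prod_fin_ite_lt {k m : ℕ} (hk : k ≤ m) (g : Fin m → ℝ) :
    (∏ i : Fin m, if i.val < k then g i else 1) = ∏ i : Fin k, g ⟨i.val, i.isLt.trans_le hk⟩ := by
  rw [← Finset.prod_filter]
  symm
  refine Finset.prod_bij (fun i _ => ⟨i.val, i.isLt.trans_le hk⟩) ?_ ?_ ?_ ?_
  · intro i _
    simp
  · intro i _ j _ hij
    simpa [Fin.ext_iff] using hij
  · intro i hi
    exact ⟨⟨i.val, by simpa using hi⟩, Finset.mem_univ _, rfl⟩
  · intro i _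
    rfl

/-- Trajectories after the first `k` deployments get weight 1, so each prefix of the data has its
own bound; the designs are computed from such prefixes. -/
theorem Scheme.prob_score_ge (alg : Scheme S A H m N) (M : MDP S A H) {k : ℕ} (hk : k ≤ m)
    (x : Fin H → S × A) (T : Fin H → Finset S) {l : Fin H → ℝ} (h0 : ∀ j, 0 ≤ l j)
    (h1 : ∀ j, l j ≤ 1) (u : ℝ) :
    alg.prob M {D | u ≤ ∑ j, (l j * M.deviation (pool (takeData D k hk)) j (x j) (stateInd (T j)) -
        l j ^ 2 * visits (pool (takeData D k hk)) j (x j))} ≤ Real.exp (-u) := by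
  refine alg.prob_le_of_le_prod M
    (fun i _ τ => if i.val < k then Real.exp (M.score x T l τ) else 1) ?_ ?_ _ ?_
  · intro i D τ
    split_ifs <;> positivity
  · intro i D
    split_ifs
    · rw [M.sum_mixTrajProb_mul]
      calc _ ≤ ∑ π, (alg.policy i D).1 π * 1 :=
            Finset.sum_le_sum fun π _ => mul_le_mul_of_nonneg_left
              (M.expect_exp_score_le_one _ x T h0 h1) ((alg.policy i D).2.1 π)
        _ = 1 := by simp [(alg.policy i D).2.2]
    · simp [M.sum_mixTrajProb]
  · intro D hD
    have : ∀ i : Fin m, (∏ n : Fin N, if i.val < k then Real.exp (M.score x T l (D i n)) else 1) =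
        if i.val < k then ∏ n : Fin N, Real.exp (M.score x T l (D i n)) else 1 := by
      intro i
      split_ifs <;> simp
    simp only [this]
    rw [prod_fin_ite_lt hk]
    simp only [← Real.exp_sum]
    refine Real.exp_le_exp.2 (le_trans hD (le_of_eq ?_))
    exact (M.sum_score_pool (takeData D k hk) x T l).symm

end Concentration

/-! ### Coverage of the layers and accumulated error -/

section Coverage

variable {S A : Type*} [Fintype S] [DecidableEq S] [Fintype A] [DecidableEq A] {H N : ℕ}

/-- A real infimum over an empty type is `0`, so `d_m > 0` excludes both degenerate cases. -/
theorem MDP.pos_and_nonempty_of_dm_pos (M : MDP S A H) (h : 0 < M.dm) : 0 < H ∧ Nonempty A := by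
  constructor
  · rcases Nat.eq_zero_or_pos H with h0 | h0
    · subst h0
      simp [MDP.dm, Real.iInf_of_isEmpty] at h
    · exact h0
  · by_contra hA
    rw [not_nonempty_iff] at hA
    have hE : ∀ h : Fin H, IsEmpty (layerPairs (A := A) M.s₁ h) :=
      fun h => ⟨fun x => hA.elim x.1.2⟩
    simp [MDP.dm, Real.iInf_of_isEmpty] at h

theorem nonempty_policy [Nonempty A] : Nonempty (Policy S A H) :=
  ⟨DetPolicy.toPolicy fun _ _ => Classical.arbitrary A⟩

/-- Below `d_m`, a mixture reaches all pairs of a layer simultaneously. -/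
theorem MDP.exists_mixOcc_ge [Nonempty A] (M : MDP S A H) {c : ℝ} (hc : c < M.dm) (h : Fin H) :
    ∃ w : Mixture S A H, ∀ x ∈ layerPairs M.s₁ h, c ≤ M.mixOcc w h x := by
  have := nonempty_policy (S := S) (A := A) (H := H)
  have h1 : c < ⨆ π : Policy S A H, ⨅ x : layerPairs (A := A) M.s₁ h, M.occ π h x.1 :=
    hc.trans_le (ciInf_le (Set.finite_range _).bddBelow h)
  obtain ⟨π, hπ⟩ := exists_lt_of_lt_ciSup h1
  obtain ⟨w, hw⟩ := M.exists_mixOcc_eq π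
  refine ⟨w, fun x hx => ?_⟩
  rw [hw]
  exact hπ.le.trans (ciInf_le (Set.finite_range
    fun x : layerPairs (A := A) M.s₁ h => M.occ π h x.1).bddBelow ⟨x, hx⟩)

theorem MDP.occ_le_one (M : MDP S A H) (π : Policy S A H) (h : Fin H) (x : S × A) :
    M.occ π h x ≤ 1 := by
  rw [← M.sum_occ π h]
  exact Finset.single_le_sum (fun y _ => M.occ_nonneg π h y) (Finset.mem_univ x)

theorem MDP.mixOcc_le_one (M : MDP S A H) (w : Mixture S A H) (h : Fin H) (x : S × A) :
    M.mixOcc w h x ≤ 1 := by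
  rw [← w.2.2]
  exact Finset.sum_le_sum fun π _ => mul_le_of_le_one_right (w.2.1 π) (M.occ_le_one _ _ _)

theorem MDP.le_one_of_lt_dm [Nonempty A] (M : MDP S A H) (hH : 0 < H) {c : ℝ} (hc : c < M.dm) :
    c ≤ 1 := by
  obtain ⟨w, hw⟩ := M.exists_mixOcc_ge hc ⟨0, hH⟩
  exact (hw (M.s₁, Classical.arbitrary A) (by simp [layerPairs])).trans (M.mixOcc_le_one _ _ _)

theorem MDP.abs_estOccMix_sub_le {I : Type*} [Fintype I] (M : MDP S A H) (D : I → Traj S A H)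
    (h : Fin H) {e : ℝ} {x : S × A}
    (he : ∀ π, |estOcc D M.s₁ h π x - M.occ (DetPolicy.toPolicy π) h x| ≤ e)
    (w : Mixture S A H) : |estOccMix D M.s₁ h w x - M.mixOcc w h x| ≤ e := by
  unfold estOccMix MDP.mixOcc
  rw [← Finset.sum_sub_distrib]
  calc _ ≤ ∑ π, |w.1 π * estOcc D M.s₁ h π x - w.1 π * M.occ (DetPolicy.toPolicy π) h x| :=
        Finset.abs_sum_le_sum_abs _ _
    _ ≤ ∑ π, w.1 π * e := by
        refine Finset.sum_le_sum fun π _ => ?_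
        rw [← mul_sub, abs_mul, abs_of_nonneg (w.2.1 π)]
        exact mul_le_mul_of_nonneg_left (he π) (w.2.1 π)
    _ = e := by rw [← Finset.sum_mul, w.2.2, one_mul]

/-- The mixture `w` covers layer `h`: it reaches every pair, and no policy visits the layer much
more often. -/
def MDP.Covers (M : MDP S A H) (η : ℝ) (h : Fin H) (w : Mixture S A H) : Prop :=
  (∀ x ∈ layerPairs M.s₁ h, η / 2 ≤ M.mixOcc w h x) ∧
    ∀ π : DetPolicy S A H, ∑ x ∈ layerPairs M.s₁ h,
      M.occ (DetPolicy.toPolicy π) h x / M.mixOcc w h x ≤ 3 * (Fintype.card S * Fintype.card A)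

/-- With accurate occupancy estimates, exploration covers the layer. -/
theorem Scheme.IsLayerwiseExploration.covers [Nonempty A] {alg : Scheme S A H H N} {M : MDP S A H}
    {η : ℝ} (halg : alg.IsLayerwiseExploration M.s₁ η) (hη : 0 < η) (hdm : 5 * η ≤ M.dm)
    (D : Fin H → Fin N → Traj S A H) (h : Fin H)
    (he : ∀ π x, |estOcc (pool (takeData D h h.isLt.le)) M.s₁ h π x -
      M.occ (DetPolicy.toPolicy π) h x| ≤ η / 8) :
    M.Covers η h (alg.deployed D h) := by
  set D' := takeData D h h.isLt.le with hD'
  have hmix := fun w x => abs_le.1 (M.abs_estOccMix_sub_le (pool D') h (fun π => he π x) w)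
  -- The supremum in `d_m` need not be attained, so a level strictly below `5 η` is used; after an
  -- error of `η / 8` it still exceeds `2 η`.
  obtain ⟨u, hu⟩ := M.exists_mixOcc_ge (show 4 * η < M.dm by linarith) h
  have hu2 : IsFeasible (pool D') M.s₁ (2 * η) h u := fun x hx => by
    linarith [hu x hx, (hmix u x).1]
  have hu1 : IsFeasible (pool D') M.s₁ η h u := fun x hx => by linarith [hu2 x hx]
  have hsol : IsDesignSolution (pool D') M.s₁ η h (alg.deployed D h) :=
    halg h D' (exists_isDesignSolution (pool D') M.s₁ hη h u hu1)
  set w := alg.deployed D h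
  refine ⟨fun x hx => by linarith [hsol.1 x hx, (hmix w x).2], fun π => ?_⟩
  -- Feasibility gives `η / 8 ≤ d / 8`: the true denominator is at least `7 d / 8` and the numerator
  -- grows by at most `d / 8`. Summed, `16 / 7 + 1 / 7 ≤ 3`.
  have hbound : ∀ x ∈ layerPairs M.s₁ h, M.occ (DetPolicy.toPolicy π) h x / M.mixOcc w h x ≤
      8 / 7 * (estOcc (pool D') M.s₁ h π x / estOccMix (pool D') M.s₁ h w x) + 1 / 7 := by
    intro x hx
    have h1 := hsol.1 x hx
    have h2 := (hmix w x).2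
    have h3 := (abs_le.1 (he π x)).1
    set d := estOccMix (pool D') M.s₁ h w x
    have hd : 0 < d := by linarith
    have hp : 7 / 8 * d ≤ M.mixOcc w h x := by linarith
    have hocc := M.occ_nonneg (DetPolicy.toPolicy π) h x
    calc _ ≤ M.occ (DetPolicy.toPolicy π) h x / (7 / 8 * d) :=
          div_le_div_of_nonneg_left hocc (by positivity) hp
      _ ≤ (estOcc (pool D') M.s₁ h π x + d / 8) / (7 / 8 * d) :=
          div_le_div_of_nonneg_right (by linarith) (by positivity)
      _ = _ := by
          field_simp
  refine (Finset.sum_le_sum hbound).trans ?_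
  rw [Finset.sum_add_distrib, ← Finset.mul_sum, Finset.sum_const, nsmul_eq_mul]
  have h4 := hsol.sum_div_le hη u hu2 π
  have h5 : ((layerPairs (A := A) M.s₁ h).card : ℝ) ≤ Fintype.card S * Fintype.card A := by
    exact_mod_cast card_layerPairs_le M.s₁ h
  have h6 : (0 : ℝ) ≤ Fintype.card S * Fintype.card A := by positivity
  linarith

theorem visits_le_visits_pool {k : ℕ} (D : Fin k → Fin N → Traj S A H) (i : Fin k) (h : Fin H)
    (x : S × A) : visits (D i) h x ≤ visits (pool D) h x := by
  unfold visits pool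
  rw [Fintype.sum_prod_type]
  exact Finset.single_le_sum (f := fun i => ∑ n, if D i n h = x then (1 : ℝ) else 0)
    (fun i _ => Finset.sum_nonneg fun n _ => by split_ifs <;> norm_num) (Finset.mem_univ i)

/-- Inverse temperature suited to the visitation probabilities near `g * η / 2`. -/
def temp (N : ℕ) (η L : ℝ) (g : ℕ) : ℝ := Real.sqrt (2 * L / (N * η * g))

theorem temp_zero (N : ℕ) (η L : ℝ) : temp N η L 0 = 0 := by simp [temp]

theorem temp_nonneg (N : ℕ) (η L : ℝ) (g : ℕ) : 0 ≤ temp N η L g := Real.sqrt_nonneg _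

theorem temp_le_one {N : ℕ} {η L : ℝ} (hL : 0 < L) (h : 2 * L ≤ N * η) (g : ℕ) :
    temp N η L g ≤ 1 := by
  rcases Nat.eq_zero_or_pos g with rfl | hg
  · simp [temp_zero]
  · refine Real.sqrt_le_one.2 ?_
    have hg' : (1 : ℝ) ≤ g := by exact_mod_cast hg
    refine div_le_one_of_le₀ ?_ ?_ <;> nlinarith

/-- The ideal temperature `√(L / (N p))` depends on the random `p`. Rounding `p` down to a multiple
`g` of `η / 2` loses at most a factor 2 in `p`, because `g ≥ 1`, and leaves only `O(1 / η)`
temperatures for the union bound. -/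
theorem exists_temp {N : ℕ} {η L p : ℝ} (hη : 0 < η) (hL : 0 < L) (hN : 0 < (N : ℝ))
    (hp : η / 2 ≤ p) (hp1 : p ≤ 1) :
    ∃ g < ⌊2 / η⌋₊ + 1, Real.sqrt (L / (N * p)) ≤ temp N η L g ∧
      temp N η L g ≤ 2 * Real.sqrt (L / (N * p)) := by
  have hp0 : 0 < p := by linarith
  refine ⟨⌊2 * p / η⌋₊, ?_, ?_, ?_⟩
  · refine Nat.lt_succ_of_le (Nat.floor_le_floor ?_)
    exact div_le_div_of_nonneg_right (by linarith) hη.le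
  all_goals
    have h1 : (1 : ℝ) ≤ 2 * p / η := by rw [le_div_iff₀ hη]; linarith
    have h2 : (1 : ℝ) ≤ ⌊2 * p / η⌋₊ := by exact_mod_cast Nat.le_floor (by exact_mod_cast h1)
    have h3 : (⌊2 * p / η⌋₊ : ℝ) ≤ 2 * p / η := Nat.floor_le (by positivity)
    have h4 : 2 * p / η < ⌊2 * p / η⌋₊ + 1 := Nat.lt_floor_add_one _
    rw [le_div_iff₀ hη] at h3
    rw [div_lt_iff₀ hη] at h4
    set g : ℝ := (⌊2 * p / η⌋₊ : ℝ)
  · refine Real.sqrt_le_sqrt ?_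
    rw [div_le_div_iff₀ (by positivity) (by positivity)]
    have := mul_le_mul_of_nonneg_left h3 (by positivity : 0 ≤ L * N)
    linarith
  · rw [temp, show (2 : ℝ) = Real.sqrt 4 by
      rw [show (4 : ℝ) = 2 ^ 2 by norm_num, Real.sqrt_sq two_pos.le],
      ← Real.sqrt_mul (by norm_num)]
    refine Real.sqrt_le_sqrt ?_
    rw [show Real.sqrt 4 = 2 by
      rw [show (4 : ℝ) = 2 ^ 2 by norm_num, Real.sqrt_sq two_pos.le], mul_div_assoc',
      div_le_div_iff₀ (by positivity) (by positivity)]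
    have h5 : p ≤ g * η := by nlinarith
    have := mul_le_mul_of_nonneg_left h5 (by positivity : 0 ≤ L * N)
    nlinarith [mul_pos (mul_pos hL hN) hp0]

/-- Local error from the supermartingale bound `l * d - l ^ 2 * n ≤ Y`. -/
theorem local_error_le {N : ℕ} {L Y p n d l : ℝ} (hL : 1 ≤ L) (hY : 0 ≤ Y) (hp : 0 < p)
    (hN : 0 < (N : ℝ)) (hLN : L ≤ N * p) (hn : N * p / 2 ≤ n)
    (hl1 : Real.sqrt (L / (N * p)) ≤ l) (hl2 : l ≤ 2 * Real.sqrt (L / (N * p)))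
    (h : l * d - l ^ 2 * n ≤ Y) :
    (d + 1) / (1 + n) ≤ (2 * Y / L + 4) * Real.sqrt (L / (N * p)) := by
  have hL0 : 0 < L := by linarith
  have hNp : 0 < N * p := mul_pos hN hp
  set z := Real.sqrt (L / (N * p)) with hz
  have hz0 : 0 < z := Real.sqrt_pos.2 (by positivity)
  have hz2 : z ^ 2 * (N * p) = L := by
    rw [hz, Real.sq_sqrt (by positivity)]
    field_simp
  have hz1 : z ≤ 1 := Real.sqrt_le_one.2 (div_le_one_of_le₀ hLN hNp.le)
  have hl0 : 0 < l := hz0.trans_le hl1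
  have hn0 : 0 < n := by linarith
  -- At the ideal temperature `z`, the term `Y / l` is at most `2 Y z n / L`, while `l n` and the
  -- regularizer's `1` are each at most `2 z n`.
  have hd : d ≤ Y / l + l * n := by
    rw [← sub_le_iff_le_add, le_div_iff₀ hl0]
    linarith
  have hYl : Y / l ≤ Y / z := div_le_div_of_nonneg_left hY hz0 hl1
  have hYz : Y / z = Y * z * (N * p) / L := by
    rw [← hz2]
    field_simp
  have h1 : Y * z * (N * p) / L ≤ Y * z * (2 * n) / L :=
    div_le_div_of_nonneg_right (mul_le_mul_of_nonneg_left (by linarith) (by positivity)) hL0.le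
  have h2 : (1 : ℝ) ≤ 2 * z * n := by
    have : 1 ≤ z * (N * p) := by
      have : z ^ 2 * (N * p) ≤ z * (N * p) := mul_le_mul_of_nonneg_right (by nlinarith) hNp.le
      linarith
    have := mul_le_mul_of_nonneg_left hn hz0.le
    linarith
  have h3 : l * n ≤ 2 * z * n := mul_le_mul_of_nonneg_right hl2 hn0.le
  rw [div_le_iff₀ (by linarith)]
  calc d + 1 ≤ Y * z * (2 * n) / L + 2 * z * n + 2 * z * n := by linarith
    _ = (2 * Y / L + 4) * z * n := by ring
    _ ≤ (2 * Y / L + 4) * z * (1 + n) := by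
        refine mul_le_mul_of_nonneg_left (by linarith) ?_
        positivity

/-- Choices of one layer in the union bound: a pair, a set of next states and a temperature. -/
abbrev Choice (S A : Type*) (η : ℝ) := (S × A) × Finset S × Fin (⌊2 / η⌋₊ + 1)

/-- Contribution of layer `j` to the exponent of the transition supermartingale. -/
def MDP.exponent {I : Type*} [Fintype I] (M : MDP S A H) (D : I → Traj S A H) (N : ℕ) (η L : ℝ)
    (j : Fin H) (c : Choice S A η) : ℝ :=
  temp N η L c.2.2 * M.deviation D j c.1 (stateInd c.2.1) -
    temp N η L c.2.2 ^ 2 * visits D j c.1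

/-- All local errors are as small as their conditional law suggests. -/
def MDP.Concentrated (M : MDP S A H) (η L : ℝ) (D : Fin H → Fin N → Traj S A H) : Prop :=
  ∀ (k : Fin (H + 1)) (f : Fin H → Choice S A η),
    ∑ j, M.exponent (pool (takeData D k (Nat.lt_succ_iff.1 k.isLt))) N η L j (f j) < H * L

/-- Visits of the pairs of each layer in its own deployment. -/
def Scheme.WellVisited (alg : Scheme S A H H N) (M : MDP S A H) (η : ℝ)
    (D : Fin H → Fin N → Traj S A H) : Prop :=
  ∀ (j : Fin H) (x : S × A), η / 2 ≤ M.mixOcc (alg.deployed D j) j x →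
    N * M.mixOcc (alg.deployed D j) j x / 2 ≤ visits (D j) j x

/-- Cauchy–Schwarz after splitting each term as `√d · √(L / N · d / p)`, with total mass of `d` at
most one. -/
theorem sum_mul_sqrt_le {X : Type*} (s : Finset X) {d p : X → ℝ} {L N B : ℝ} (hL : 0 ≤ L)
    (hN : 0 ≤ N) (hd : ∀ x ∈ s, 0 ≤ d x) (hp : ∀ x ∈ s, 0 < p x) (hsum : ∑ x ∈ s, d x ≤ 1)
    (hB : ∑ x ∈ s, d x / p x ≤ B) :
    ∑ x ∈ s, d x * Real.sqrt (L / (N * p x)) ≤ Real.sqrt (L * B / N) := by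
  have h1 : ∀ x ∈ s, d x * Real.sqrt (L / (N * p x)) =
      Real.sqrt (d x) * Real.sqrt (L / N * (d x / p x)) := by
    intro x hx
    rw [← Real.sqrt_mul (hd x hx), show d x * (L / N * (d x / p x)) = d x ^ 2 * (L / (N * p x)) by
      rw [div_mul_div_comm]; ring, Real.sqrt_mul (sq_nonneg _), Real.sqrt_sq (hd x hx)]
  rw [Finset.sum_congr rfl h1]
  have h2 : ∀ x ∈ s, 0 ≤ L / N * (d x / p x) := fun x hx =>
    mul_nonneg (by positivity) (div_nonneg (hd x hx) (hp x hx).le)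
  refine (Real.sum_mul_le_sqrt_mul_sqrt s _ _).trans ?_
  rw [Finset.sum_congr rfl fun x hx => Real.sq_sqrt (hd x hx),
    Finset.sum_congr rfl fun x hx => Real.sq_sqrt (h2 x hx), ← Finset.mul_sum]
  have hs : Real.sqrt (∑ x ∈ s, d x) ≤ 1 := Real.sqrt_le_one.2 hsum
  calc _ ≤ 1 * Real.sqrt (L / N * ∑ x ∈ s, d x / p x) :=
        mul_le_mul_of_nonneg_right hs (Real.sqrt_nonneg _)
    _ ≤ Real.sqrt (L * B / N) := by
        rw [one_mul]
        refine Real.sqrt_le_sqrt ?_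
        rw [mul_div_right_comm]
        exact mul_le_mul_of_nonneg_left hB (by positivity)

/-- Accumulated estimation error of the layers that are already covered. -/
theorem Scheme.value_localErr_le [Nonempty A] {alg : Scheme S A H H N} {M : MDP S A H}
    {η L : ℝ} (hη : 0 < η) (hL : 1 ≤ L) (hLN : 2 * L ≤ N * η)
    {D : Fin H → Fin N → Traj S A H} (hconc : M.Concentrated η L D)
    (hvis : alg.WellVisited M η D) (k : Fin (H + 1))
    (hcov : ∀ j : Fin H, j.val < k.val → M.Covers η j (alg.deployed D j)) (π : DetPolicy S A H) :
    M.value (DetPolicy.toPolicy π) (fun j s a => if j.val < k.val then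
      M.localErr (pool (takeData D k (Nat.lt_succ_iff.1 k.isLt))) j (s, a) else 0) ≤
      6 * H * Real.sqrt (L * (3 * (Fintype.card S * Fintype.card A)) / N) := by
  have : Nonempty S := ⟨M.s₁⟩
  have hL0 : 0 < L := by linarith
  have hNη : 0 < N * η := by linarith
  have hN : 0 < (N : ℝ) := pos_of_mul_pos_left hNη hη.le
  have hk := Nat.lt_succ_iff.1 k.isLt
  set D' := pool (takeData D k hk) with hD'
  -- Take the worst choice separately in every layer; `MDP.Concentrated` then bounds the sum of
  -- these maxima by `H L`.
  have hmax : ∀ j : Fin H, ∃ c : Choice S A η, ∀ c', M.exponent D' N η L j c' ≤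
      M.exponent D' N η L j c := fun j => Finite.exists_max _
  choose f hf using hmax
  have hY0 : ∀ j, 0 ≤ M.exponent D' N η L j (f j) := by
    intro j
    -- Temperature index 0 denotes temperature 0 (a division by zero), so exponent 0 is always among
    -- the choices.
    refine le_trans (le_of_eq ?_) (hf j ((M.s₁, Classical.arbitrary A), ∅, 0))
    simp [MDP.exponent, temp_zero]
  have hYsum := hconc k f
  set R := Real.sqrt (L * (3 * (Fintype.card S * Fintype.card A)) / N) with hR
  have hR0 : 0 ≤ R := Real.sqrt_nonneg _
  have hlayer : ∀ j : Fin H, ∑ x : S × A, M.occ (DetPolicy.toPolicy π) j x *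
      (if j.val < k.val then M.localErr D' j (x.1, x.2) else 0) ≤
      (2 * M.exponent D' N η L j (f j) / L + 4) * R := by
    intro j
    have hc0 : 0 ≤ 2 * M.exponent D' N η L j (f j) / L + 4 := by
      have := hY0 j
      positivity
    by_cases hj : j.val < k.val
    · simp only [if_pos hj]
      obtain ⟨hc1, hc2⟩ := hcov j hj
      rw [← Finset.sum_subset (Finset.subset_univ (layerPairs M.s₁ j))
        (fun x _ hx => by rw [M.occ_eq_zero _ _ _ hx, zero_mul])]
      have hloc : ∀ x ∈ layerPairs M.s₁ j, M.localErr D' j x ≤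
          (2 * M.exponent D' N η L j (f j) / L + 4) *
            Real.sqrt (L / (N * M.mixOcc (alg.deployed D j) j x)) := by
        intro x hx
        have hp := hc1 x hx
        obtain ⟨g, hg, hg1, hg2⟩ := exists_temp hη hL0 hN hp (M.mixOcc_le_one _ _ _)
        obtain ⟨T, hT⟩ := M.exists_maxDev_eq D' j x
        have hexp := hf j (x, T, ⟨g, hg⟩)
        rw [MDP.exponent, ← hT] at hexp
        refine local_error_le hL (hY0 j) (by linarith) hN ?_ ?_ hg1 hg2 hexp
        · have := mul_le_mul_of_nonneg_left hp hN.le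
          linarith
        · exact (hvis j x hp).trans (visits_le_visits_pool (takeData D k hk) ⟨j.val, hj⟩ j x)
      have hocc1 : ∑ x ∈ layerPairs M.s₁ j, M.occ (DetPolicy.toPolicy π) j x ≤ 1 := by
        rw [← M.sum_occ (DetPolicy.toPolicy π) j]
        exact Finset.sum_le_sum_of_subset_of_nonneg (Finset.subset_univ _)
          fun x _ _ => M.occ_nonneg _ _ _
      calc _ ≤ ∑ x ∈ layerPairs M.s₁ j, (2 * M.exponent D' N η L j (f j) / L + 4) *
            (M.occ (DetPolicy.toPolicy π) j x *
              Real.sqrt (L / (N * M.mixOcc (alg.deployed D j) j x))) := by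
            refine Finset.sum_le_sum fun x hx => ?_
            rw [mul_left_comm]
            exact mul_le_mul_of_nonneg_left (hloc x hx) (M.occ_nonneg _ _ _)
        _ ≤ _ := by
            rw [← Finset.mul_sum]
            exact mul_le_mul_of_nonneg_left (sum_mul_sqrt_le _ hL0.le hN.le
              (fun x _ => M.occ_nonneg _ _ _) (fun x hx => by linarith [hc1 x hx]) hocc1
              (hc2 π)) hc0
    · simp only [if_neg hj, mul_zero, Finset.sum_const_zero]
      positivity
  rw [M.value_eq_sum_occ]
  refine (Finset.sum_le_sum fun j _ => hlayer j).trans ?_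
  rw [← Finset.sum_mul]
  refine mul_le_mul_of_nonneg_right ?_ hR0
  rw [Finset.sum_add_distrib, ← Finset.sum_div, ← Finset.mul_sum]
  simp only [Finset.sum_const, Finset.card_univ, Fintype.card_fin, nsmul_eq_mul]
  -- The sum of `2 Y / L + 4` over layers is at most `2 H + 4 H`, the origin of the factor `6 H`.
  have : 2 * ∑ j, M.exponent D' N η L j (f j) / L ≤ 2 * H := by
    rw [← Finset.sum_div]
    refine mul_le_mul_of_nonneg_left ?_ two_pos.le
    rw [div_le_iff₀ hL0]
    exact hYsum.le
  rw [mul_div_assoc, Finset.sum_div]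
  linarith

theorem Scheme.IsLayerwiseExploration.isEpsOptimal [Nonempty A] {alg : Scheme S A H H N}
    {M : MDP S A H} {η L : ℝ} (halg : alg.IsLayerwiseExploration M.s₁ η) (hη : 0 < η)
    (hdm : 5 * η ≤ M.dm) (hL : 1 ≤ L) (hLN : 2 * L ≤ N * η)
    (hbudget : 6 * H * Real.sqrt (L * (3 * (Fintype.card S * Fintype.card A)) / N) ≤ η / 8)
    {D : Fin H → Fin N → Traj S A H} (hconc : M.Concentrated η L D)
    (hvis : alg.WellVisited M η D) {r : Reward S A H} (hr : IsValidReward r)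
    {π : DetPolicy S A H} (hπ : IsPlanningOutput (pool D) M.s₁ r π) :
    M.IsEpsOptimal (H * η) r (DetPolicy.toPolicy π) := by
  -- The estimates used at layer `j` involve only layers before `j`, covered by induction, and only
  -- the data of their deployments.
  have hcov : ∀ n, ∀ j : Fin H, j.val < n → M.Covers η j (alg.deployed D j) := by
    intro n
    induction n with
    | zero => exact fun j hj => absurd hj (Nat.not_lt_zero _)
    | succ n ih =>
      intro j hj
      refine halg.covers hη hdm D j fun ρ x => ?_
      refine (M.abs_estOcc_sub_occ_le (pool (takeData D j j.isLt.le)) j ρ x).trans ?_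
      exact (alg.value_localErr_le hη hL hLN hconc hvis j.castSucc
        (fun i hi => ih i (lt_of_lt_of_le hi (Nat.lt_succ_iff.1 hj))) ρ).trans hbudget
  have herr : ∀ ρ : DetPolicy S A H,
      |estimateV (pool D) M.s₁ ρ r - M.value (DetPolicy.toPolicy ρ) r| ≤ H * (η / 8) := by
    intro ρ
    refine (M.abs_estimateV_sub_value_le (pool D) ρ r hr).trans ?_
    have h1 := (alg.value_localErr_le hη hL hLN hconc hvis (Fin.last H)
      (fun i hi => hcov H i hi) ρ).trans hbudget
    have h2 : M.value (DetPolicy.toPolicy ρ) (fun j s a => H * M.localErr (pool D) j (s, a)) =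
        H * M.value (DetPolicy.toPolicy ρ) (fun j s a => if j.val < (Fin.last H).val then
          M.localErr (pool (takeData D (Fin.last H) le_rfl)) j (s, a) else 0) := by
      rw [M.value_eq_sum_occ, M.value_eq_sum_occ, Finset.mul_sum]
      refine Finset.sum_congr rfl fun j _ => ?_
      rw [Finset.mul_sum]
      refine Finset.sum_congr rfl fun x _ => ?_
      rw [if_pos (show j.val < (Fin.last H).val from j.isLt), mul_left_comm]
      rfl
    rw [h2]
    exact mul_le_mul_of_nonneg_left h1 (Nat.cast_nonneg _)
  have := nonempty_policy (S := S) (A := A) (H := H)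
  rw [MDP.IsEpsOptimal, sub_le_iff_le_add]
  refine ciSup_le fun ρ' => ?_
  obtain ⟨ρ, hρ⟩ := M.exists_value_le ρ' r
  have h1 := (abs_le.1 (herr ρ)).1
  have h2 := (abs_le.1 (herr π)).2
  have h3 := hπ ρ
  have h4 : (0 : ℝ) ≤ H * η := by positivity
  linarith

end Coverage

/-! ### Failure probabilities -/

section Probability

variable {S A : Type*} [Fintype S] [DecidableEq S] [Fintype A] [DecidableEq A] {H N : ℕ}

/-- The number of choice functions is the `H`-th power of the number of choices, and `exp (-(H L))`
pays for each layer separately. The `H + 1` prefixes are absorbed by `2 ^ H`, so no `log H` enters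
`L`. -/
theorem Scheme.prob_not_concentrated_le (alg : Scheme S A H H N) (M : MDP S A H) {η L δ : ℝ}
    (hH : 0 < H) (hδ : 0 < δ) (hδ1 : δ < 1) (hL : 0 < L) (hLN : 2 * L ≤ N * η)
    (hK : (Fintype.card (Choice S A η) : ℝ) * Real.exp (-L) ≤ δ / 8) :
    alg.prob M {D | ¬ M.Concentrated η L D} ≤ δ / 2 := by
  set E : Fin (H + 1) × (Fin H → Choice S A η) → Set (Fin H → Fin N → Traj S A H) :=
    fun kf => {D | H * L ≤ ∑ j, M.exponent
      (pool (takeData D kf.1 (Nat.lt_succ_iff.1 kf.1.isLt))) N η L j (kf.2 j)} with hE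
  have hsub : {D | ¬ M.Concentrated η L D} ⊆ ⋃ kf, E kf := by
    intro D hD
    simp only [MDP.Concentrated, Set.mem_ofPred_eq, not_forall, not_lt] at hD
    obtain ⟨k, f, hkf⟩ := hD
    exact Set.mem_iUnion.2 ⟨(k, f), hkf⟩
  have hprob : ∀ kf, alg.prob M (E kf) ≤ Real.exp (-(H * L)) := fun kf =>
    alg.prob_score_ge M (Nat.lt_succ_iff.1 kf.1.isLt) (fun j => (kf.2 j).1)
      (fun j => (kf.2 j).2.1) (l := fun j => temp N η L (kf.2 j).2.2)
      (fun j => temp_nonneg _ _ _ _) (fun j => temp_le_one hL hLN _) _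
  refine (alg.prob_mono M hsub).trans ((alg.prob_iUnion_le M E).trans
    ((Finset.sum_le_sum fun kf _ => hprob kf).trans ?_))
  rw [Finset.sum_const, Finset.card_univ, nsmul_eq_mul, Fintype.card_prod, Fintype.card_fun,
    Fintype.card_fin, Fintype.card_fin]
  push_cast
  have hpow : Real.exp (-(H * L)) = Real.exp (-L) ^ H := by
    rw [← Real.exp_nat_mul]
    ring_nf
  rw [hpow, mul_assoc, ← mul_pow]
  have h1 : ((Fintype.card (Choice S A η) : ℝ) * Real.exp (-L)) ^ H ≤ (δ / 8) ^ H :=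
    pow_le_pow_left₀ (by positivity) hK H
  have h2 : ((H : ℝ) + 1) ≤ 2 ^ H := by exact_mod_cast Nat.lt_two_pow_self
  calc ((H : ℝ) + 1) * ((Fintype.card (Choice S A η) : ℝ) * Real.exp (-L)) ^ H
      ≤ 2 ^ H * (δ / 8) ^ H := mul_le_mul h2 h1 (by positivity) (by positivity)
    _ = (δ / 4) ^ H := by rw [← mul_pow]; ring_nf
    _ ≤ (δ / 4) ^ 1 := pow_le_pow_of_le_one (by positivity) (by linarith) hH
    _ ≤ δ / 2 := by linarith

theorem Scheme.prob_not_wellVisited_le (alg : Scheme S A H H N) (M : MDP S A H) {η δ : ℝ}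
    (hK : (H : ℝ) * (Fintype.card S * Fintype.card A) * Real.exp (-(N * (η / 2) / 8)) ≤ δ / 2) :
    alg.prob M {D | ¬ alg.WellVisited M η D} ≤ δ / 2 := by
  set E : Fin H × (S × A) → Set (Fin H → Fin N → Traj S A H) :=
    fun jx => {D | η / 2 ≤ M.mixOcc (alg.deployed D jx.1) jx.1 jx.2 ∧
      visits (D jx.1) jx.1 jx.2 < N * M.mixOcc (alg.deployed D jx.1) jx.1 jx.2 / 2} with hE
  have hsub : {D | ¬ alg.WellVisited M η D} ⊆ ⋃ jx, E jx := by
    intro D hD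
    simp only [Scheme.WellVisited, Set.mem_ofPred_eq, not_forall, not_le] at hD
    obtain ⟨j, x, h1, h2⟩ := hD
    exact Set.mem_iUnion.2 ⟨(j, x), h1, h2⟩
  refine (alg.prob_mono M hsub).trans ((alg.prob_iUnion_le M E).trans
    ((Finset.sum_le_sum fun jx _ => alg.prob_visits_lt M jx.1 jx.1 jx.2 (η / 2)).trans ?_))
  rw [Finset.sum_const, Finset.card_univ, nsmul_eq_mul, Fintype.card_prod, Fintype.card_fin,
    Fintype.card_prod]
  push_cast
  exact hK

theorem Scheme.IsLayerwiseExploration.one_sub_le_prob [Nonempty A] {alg : Scheme S A H H N}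
    {M : MDP S A H} {η L δ : ℝ} (halg : alg.IsLayerwiseExploration M.s₁ η) (hη : 0 < η)
    (hH : 0 < H) (hδ : 0 < δ) (hδ1 : δ < 1) (hdm : 5 * η ≤ M.dm) (hL : 1 ≤ L)
    (hLN : 2 * L ≤ N * η)
    (hbudget : 6 * H * Real.sqrt (L * (3 * (Fintype.card S * Fintype.card A)) / N) ≤ η / 8)
    (hK₁ : (Fintype.card (Choice S A η) : ℝ) * Real.exp (-L) ≤ δ / 8)
    (hK₂ : (H : ℝ) * (Fintype.card S * Fintype.card A) * Real.exp (-(N * (η / 2) / 8)) ≤ δ / 2) :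
    1 - δ ≤ alg.prob M {D | ∀ r : Reward S A H, IsValidReward r → ∀ π : DetPolicy S A H,
      IsPlanningOutput (pool D) M.s₁ r π → M.IsEpsOptimal (H * η) r (DetPolicy.toPolicy π)} := by
  have hP₁ := alg.prob_not_concentrated_le M hH hδ hδ1 (by linarith) hLN hK₁
  have hP₂ := alg.prob_not_wellVisited_le M hK₂
  refine le_trans ?_ (alg.one_sub_le_prob M (B₁ := {D | ¬ M.Concentrated η L D})
    (B₂ := {D | ¬ alg.WellVisited M η D}) fun D h₁ h₂ r hr π hπ => ?_)
  · linarith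
  · exact halg.isEpsOptimal hη hdm hL hLN hbudget (not_not.1 h₁) (not_not.1 h₂) hr hπ

end Probability

/-! ### Arithmetic of the parameters -/

section Parameters

theorem one_le_natCast {n : ℕ} (h : 0 < n) : (1 : ℝ) ≤ n := by exact_mod_cast h

/-- In terms of `η = ε / H`, the logarithm `ι` sees `S A / (η δ)` and `H` disappears. -/
theorem exp_iota {S A H : ℕ} {ε δ : ℝ} (hS : 0 < S) (hA : 0 < A) (hH : 0 < H) (hε : 0 < ε)
    (hδ : 0 < δ) : Real.exp (iota S A H ε δ) = S * A / (ε / H * δ) := by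
  have hS' : (0 : ℝ) < S := by exact_mod_cast hS
  have hA' : (0 : ℝ) < A := by exact_mod_cast hA
  have hH' : (0 : ℝ) < H := by exact_mod_cast hH
  rw [iota, Real.exp_log (by positivity)]
  field_simp

theorem one_le_iota {S A H : ℕ} {ε δ : ℝ} (hS : 0 < S) (hA : 0 < A) (hH : 0 < H) (hε : 0 < ε)
    (hδ : 0 < δ) (hδ1 : δ < 1) (hη : ε / H ≤ 1 / 4) : 1 ≤ iota S A H ε δ := by
  have hH' : (0 : ℝ) < H := by exact_mod_cast hH
  rw [← Real.exp_le_exp, exp_iota hS hA hH hε hδ]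
  have h1 : ε / H * δ ≤ 1 / 4 := by
    have : 0 < ε / H := by positivity
    nlinarith
  have h2 : (1 : ℝ) ≤ S * A := one_le_mul_of_one_le_of_one_le (one_le_natCast hS) (one_le_natCast hA)
  rw [le_div_iff₀ (by positivity)]
  have h3 : Real.exp 1 * (ε / H * δ) ≤ 3 * (1 / 4) :=
    mul_le_mul (by linarith [Real.exp_one_lt_d9]) h1 (by positivity) (by norm_num)
  linarith

theorem threshold_eq {S A H : ℕ} {ε δ : ℝ} (hS : 0 < S) (hH : 0 < H)
    (hι : 0 < iota S A H ε δ) : threshold 1 1 S A H ε δ = ε / H := by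
  have hS' : (0 : ℝ) < S := by exact_mod_cast hS
  have hH' : (0 : ℝ) < H := by exact_mod_cast hH
  have : 0 < Real.sqrt S := Real.sqrt_pos.2 hS'
  unfold threshold epsBar
  field_simp

theorem batchSize_eq {C₂ : ℝ} {S A H : ℕ} {ε δ : ℝ} (hS : 0 < S) (hH : 0 < H)
    (hε : 0 < ε) (hι : 0 < iota S A H ε δ) : batchSize 1 C₂ S A H ε δ =
      ⌈C₂ * (S ^ 2 * A * H ^ 2 * iota S A H ε δ ^ 3 / (ε / H) ^ 2)⌉₊ := by
  have hS' : (0 : ℝ) < S := by exact_mod_cast hS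
  have hH' : (0 : ℝ) < H := by exact_mod_cast hH
  have h1 : 0 < Real.sqrt S := Real.sqrt_pos.2 hS'
  have h2 : Real.sqrt S ^ 2 = S := Real.sq_sqrt hS'.le
  have h3 : epsBar 1 S A H ε δ ^ 2 = ε ^ 2 / (H ^ 4 * S * iota S A H ε δ ^ 2) := by
    unfold epsBar
    rw [div_pow, mul_pow, mul_pow, mul_pow, h2]
    ring
  unfold batchSize
  rw [h3]
  congr 1
  field_simp

theorem card_choice_mul_exp_le {S A : Type*} [Fintype S] [Fintype A] {η δ ι : ℝ}
    (hS : 0 < Fintype.card S) (hη : 0 < η) (hη1 : η ≤ 1 / 4) (hδ : 0 < δ) (hι : 1 ≤ ι)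
    (hexp : Real.exp ι = Fintype.card S * Fintype.card A / (η * δ)) :
    (Fintype.card (Choice S A η) : ℝ) * Real.exp (-(10 * Fintype.card S * ι)) ≤ δ / 8 := by
  have hs : (1 : ℝ) ≤ Fintype.card S := one_le_natCast hS
  have hcard : (Fintype.card (Choice S A η) : ℝ) =
      Fintype.card S * Fintype.card A * (2 ^ Fintype.card S * (⌊2 / η⌋₊ + 1)) := by
    simp [Choice, Fintype.card_prod]
  have hfloor : ((⌊2 / η⌋₊ : ℝ) + 1) ≤ 3 / η := by
    have h1 : (⌊2 / η⌋₊ : ℝ) ≤ 2 / η := Nat.floor_le (by positivity)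
    have h2 : 1 ≤ 1 / η := by rw [le_div_iff₀ hη]; linarith
    have h3 : 3 / η = 2 / η + 1 / η := by ring
    linarith
  have hsa : (Fintype.card S : ℝ) * Fintype.card A = Real.exp ι * (η * δ) := by
    rw [hexp]
    field_simp
  have h2 : (2 : ℝ) ^ Fintype.card S ≤ Real.exp (Fintype.card S) := by
    rw [← mul_one (Fintype.card S : ℝ), Real.exp_nat_mul]
    exact pow_le_pow_left₀ two_pos.le (by linarith [Real.exp_one_gt_d9]) _
  have h24 : (24 : ℝ) ≤ Real.exp 8 := by
    have : (2 : ℝ) ^ 8 ≤ Real.exp 1 ^ 8 :=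
      pow_le_pow_left₀ two_pos.le (by linarith [Real.exp_one_gt_d9]) 8
    rw [← Real.exp_nat_mul] at this
    norm_num at this
    linarith
  -- The terms `ι`, `S` and 8 pay for pairs together with `1 / (η δ)`, for sets of states, and for
  -- the constant 24.
  have hle : ι + Fintype.card S + 8 ≤ 10 * Fintype.card S * ι := by nlinarith
  rw [Real.exp_neg, ← div_eq_mul_inv, div_le_iff₀ (Real.exp_pos _), hcard, hsa]
  calc Real.exp ι * (η * δ) * (2 ^ Fintype.card S * (⌊2 / η⌋₊ + 1))
      ≤ Real.exp ι * (η * δ) * (Real.exp (Fintype.card S) * (3 / η)) := by gcongr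
    _ = δ / 8 * (Real.exp ι * Real.exp (Fintype.card S) * 24) := by
        field_simp
        ring
    _ ≤ δ / 8 * (Real.exp ι * Real.exp (Fintype.card S) * Real.exp 8) := by gcongr
    _ = δ / 8 * Real.exp (ι + Fintype.card S + 8) := by rw [Real.exp_add, Real.exp_add]
    _ ≤ _ := by gcongr

/-- Here a plain union over layers is affordable: `N η` carries a factor `H`, so the exponent `N η /
16` is at least `H + ι`, and `H ≤ exp H`. -/
theorem mul_exp_neg_le {H s η δ ι n : ℝ} (hη : 0 < η) (hη1 : η ≤ 1 / 4) (hδ : 0 < δ)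
    (hH : 1 ≤ H) (hι : 1 ≤ ι) (hexp : Real.exp ι = s / (η * δ)) (hn : 48 * (H * ι) ≤ n * η) :
    H * s * Real.exp (-(n * (η / 2) / 8)) ≤ δ / 2 := by
  have hs : s = Real.exp ι * (η * δ) := by
    rw [hexp]
    field_simp
  have h1 : Real.exp (-(n * (η / 2) / 8)) ≤ Real.exp (-(H + ι)) := by
    refine Real.exp_le_exp.2 ?_
    nlinarith
  have h2 : H ≤ Real.exp H := by linarith [Real.add_one_le_exp H]
  have hH0 : 0 < H := by linarith
  have hs0 : 0 ≤ s := by rw [hs]; positivity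
  calc H * s * Real.exp (-(n * (η / 2) / 8)) ≤ Real.exp H * s * Real.exp (-(H + ι)) := by gcongr
    _ = Real.exp H * Real.exp ι * Real.exp (-(H + ι)) * (η * δ) := by rw [hs]; ring
    _ = η * δ := by rw [← Real.exp_add, ← Real.exp_add]; simp
    _ ≤ δ / 2 := by nlinarith

end Parameters

end TabularRF

end

/-! ### Choice of constants and conclusion -/

open TabularRF in
theorem theoremH1 :
    ∃ C₁ C₂ C₃ C₄ C : ℝ, 0 < C₁ ∧ 0 < C₂ ∧ 0 < C₃ ∧ 0 < C₄ ∧ 0 < C ∧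
      ∀ (S A : Type*) [Fintype S] [DecidableEq S] [Fintype A] [DecidableEq A] (H : ℕ)
        (M : TabularRF.MDP S A H) (ε δ : ℝ),
        0 < M.dm → 0 < ε → 0 < δ → δ < 1 →
        ε ≤ H * M.dm / (C₄ * Fintype.card S * Fintype.card A) →
        ∀ alg : TabularRF.Scheme S A H H
            (TabularRF.batchSize C₁ C₂ (Fintype.card S) (Fintype.card A) H ε δ),
          alg.IsLayerwiseExploration M.s₁
            (TabularRF.threshold C₁ C₃ (Fintype.card S) (Fintype.card A) H ε δ) →
          1 - δ ≤ alg.prob M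
              {D | ∀ r : TabularRF.Reward S A H, TabularRF.IsValidReward r →
                ∀ π : TabularRF.DetPolicy S A H,
                  TabularRF.IsPlanningOutput (TabularRF.pool D) M.s₁ r π →
                    M.IsEpsOptimal ε r (TabularRF.DetPolicy.toPolicy π)} ∧
            alg.deployments = H ∧
            (alg.trajectories : ℝ) ≤
              C * ((Fintype.card S : ℝ) ^ 2 * Fintype.card A * (H : ℝ) ^ 5 / ε ^ 2) *
                Real.log ((Fintype.card S : ℝ) * Fintype.card A * H / (ε * δ)) ^ 3 := by
  refine ⟨1, 100000, 1, 5, 100001, one_pos, by norm_num, one_pos, by norm_num, by norm_num, ?_⟩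
  intro S A _ _ _ _ H M ε δ hdm hε hδ hδ1 hεdm
  obtain ⟨hH, hA⟩ := M.pos_and_nonempty_of_dm_pos hdm
  have hSc : 0 < Fintype.card S := Fintype.card_pos_iff.2 ⟨M.s₁⟩
  have hAc : 0 < Fintype.card A := Fintype.card_pos
  have hS1 : (1 : ℝ) ≤ Fintype.card S := one_le_natCast hSc
  have hA1 : (1 : ℝ) ≤ Fintype.card A := one_le_natCast hAc
  have hH1 : (1 : ℝ) ≤ H := one_le_natCast hH
  have hH0 : (0 : ℝ) < H := by linarith
  have hη : 0 < ε / H := by positivity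
  -- `C₄ = 5` serves only here; the factor `S A` in the assumption on `ε` is discarded.
  have hηdm : 5 * (ε / H) ≤ M.dm := by
    rw [le_div_iff₀ (by positivity)] at hεdm
    rw [mul_div_assoc', div_le_iff₀ hH0]
    have : (1 : ℝ) ≤ Fintype.card S * Fintype.card A :=
      one_le_mul_of_one_le_of_one_le hS1 hA1
    nlinarith
  have hη1 : ε / H ≤ 1 / 4 := by
    have := M.le_one_of_lt_dm hH (show 4 * (ε / H) < M.dm by linarith)
    linarith
  have hι := one_le_iota hSc hAc hH hε hδ hδ1 hη1
  have hexp := exp_iota hSc hAc hH hε hδ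
  rw [threshold_eq hSc hH (by linarith)]
  have hbatch := batchSize_eq (C₂ := 100000) (A := Fintype.card A) (δ := δ) hSc hH hε (by linarith)
  rw [← iota]
  have hεη : ε = H * (ε / H) := by field_simp
  generalize batchSize 1 100000 (Fintype.card S) (Fintype.card A) H ε δ = N at hbatch ⊢
  intro alg halg
  set ι := iota (Fintype.card S) (Fintype.card A) H ε δ
  set η := ε / H with hηdef
  set s : ℝ := (Fintype.card S : ℝ)
  set a : ℝ := (Fintype.card A : ℝ)
  set X : ℝ := s ^ 2 * a * H ^ 2 * ι ^ 3 / η ^ 2 with hX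
  have hXη : X * η ^ 2 = s ^ 2 * a * H ^ 2 * ι ^ 3 := by
    rw [hX]
    field_simp
  have hNX : 100000 * X ≤ N := by
    rw [hbatch]
    exact Nat.le_ceil _
  have hbig : s ^ 2 * a * H ^ 2 * ι ^ 3 ≤ X * η := by
    rw [← hXη]
    have : 0 ≤ X := by positivity
    nlinarith [mul_nonneg this hη.le]
  have hsι : s * ι ≤ s ^ 2 * a * H ^ 2 * ι ^ 3 := by
    calc s * ι = s ^ 1 * 1 * 1 ^ 2 * ι ^ 1 := by ring
      _ ≤ _ := by gcongr <;> first | assumption | norm_num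
  have hHι : H * ι ≤ s ^ 2 * a * H ^ 2 * ι ^ 3 := by
    calc H * ι = 1 ^ 2 * 1 * (H : ℝ) ^ 1 * ι ^ 1 := by ring
      _ ≤ _ := by gcongr <;> first | assumption | norm_num
  have hNη : 100000 * (X * η) ≤ N * η := by
    rw [← mul_assoc]
    exact mul_le_mul_of_nonneg_right hNX hη.le
  have hN0 : (0 : ℝ) < N := lt_of_lt_of_le (by positivity) hNX
  have hL : 1 ≤ 10 * s * ι := by nlinarith
  have hLN : 2 * (10 * s * ι) ≤ N * η := by linarith
  have hbudget : 6 * H * Real.sqrt (10 * s * ι * (3 * (s * a)) / N) ≤ η / 8 := by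
    -- Squaring requires `N ≥ 48 ^ 2 * 30 * s ^ 2 * a * H ^ 2 * ι / η ^ 2`; as `48 ^ 2 * 30 = 69120`
    -- and `ι ≥ 1`, the constant `C₂ = 100000` suffices.
    have h1 : Real.sqrt (10 * s * ι * (3 * (s * a)) / N) ≤ η / (48 * H) := by
      refine Real.sqrt_le_iff.2 ⟨by positivity, ?_⟩
      rw [div_pow, div_le_div_iff₀ hN0 (by positivity)]
      have h2 : η ^ 2 * (100000 * X) ≤ η ^ 2 * N := mul_le_mul_of_nonneg_left hNX (by positivity)
      have h3 : s ^ 2 * a * H ^ 2 * ι ≤ s ^ 2 * a * H ^ 2 * ι ^ 3 := by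
        refine mul_le_mul_of_nonneg_left ?_ (by positivity)
        exact le_self_pow₀ hι (by norm_num)
      have h4 : 0 ≤ s ^ 2 * a * H ^ 2 * ι := by positivity
      nlinarith
    calc _ ≤ 6 * H * (η / (48 * H)) := by gcongr
      _ = η / 8 := by
        field_simp
        norm_num
  refine ⟨?_, rfl, ?_⟩
  · have hprob := halg.one_sub_le_prob hη hH hδ hδ1 hηdm hL hLN hbudget
      (card_choice_mul_exp_le hSc hη hη1 hδ hι hexp)
      (mul_exp_neg_le hη hη1 hδ hH1 hι hexp (by linarith))
    rwa [← hεη] at hprob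
  · have hcount : (alg.trajectories : ℝ) = H * N := by
      simp [Scheme.trajectories]
    -- This absorbs the rounding of `N`, whence `C = C₂ + 1`.
    have hX1 : 1 ≤ X := by
      have h1 : X * η ≤ X * 1 := mul_le_mul_of_nonneg_left (by linarith) (by positivity)
      nlinarith
    have hN : (N : ℝ) ≤ 100001 * X := by
      rw [hbatch]
      have := Nat.ceil_lt_add_one (show 0 ≤ 100000 * X by positivity)
      linarith
    rw [hcount]
    calc (H : ℝ) * N ≤ H * (100001 * X) := by gcongr
      _ = _ := by
        rw [hX, hηdef]
        field_simp
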